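/- Let $\Sigma$ be a finite alphabet and let $Y \subset \Sigma^{\mathbb{Z}}$ and $Z \subset (\Sigma^2)^{\mathbb{Z}}$ be sofic shifts (images of subshifts of finite type under continuous shift-commuting maps) such that $Z \cap Y^2$ is an equivalence relation on $Y$; let $Y/Z$ be the topological quotient of $Y$ by this relation. For $m \in \mathbb{N}$ let $G_m$ be the graph whose nodes are the words of $Y$ of length $2m+1$, with an edge $(u,v)$ if and only if $([u] \times [v]) \cap Z \neq \emptyset$ (cylinders taken in $Y$ and centered at the origin; every node has a self-loop), and let $d_m(u,v) \in \mathbb{N} \cup \{\infty\}$ be the path distance of $G_m$, i.e. the least length of a path of length at least $1$ from $u$ to $v$ (so $d_m(u,u) = 1$, and $d_m(u,v)=\infty$ if there is no path). Pseudometrics below may take the value $\infty$. Then for some $c \in \mathbb{N}$ there is a greatest (hence a unique maximal) pseudometric $d : Y^2 \to [0,\infty]$ satisfying \[ \forall n \in \mathbb{N}: \quad d(x,y) \leq d_{cn}(x_{[-cn,cn]}, y_{[-cn,cn]}) / 2^{n-1} \quad \text{for all } x, y \in Y, \] and it has the following properties. \begin{itemize} \item $d(x,y) = \infty$ if and only if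 $x_0$ and $y_0$ lie in different connected components of the graph $G_0$ (so $d$ is real-valued if $G_0$ is connected). \item $d$ metrizes $Y/Z$: we have $d(x,y)=0$ if and only if $(x,y) \in Z$, and the topology of the metric induced by $d$ on $Y/Z$ is the quotient topology. \item $d$ is upper semicomputable: there is an algorithm that, given $x, y \in Y$ as oracles and $m \in \mathbb{N}$, computes $s_m \in \mathbb{Q}_{\geq 0} \cup \{\infty\}$, such that $(s_m)_m$ is a nonincreasing sequence converging to $d(x,y)$. \item There is an algorithm that, given $x, y \in Y$ as oracles and a rational $\epsilon > 0$, computes $r \in \mathbb{Q}_{\geq 0} \cup \{\infty\}$ such that $d(x,y) \in [r, \frac52 r + \epsilon]$ (so $r$ is rational if $d(x,y) < \infty$, and $r=\infty$ otherwise). \end{itemize} The same holds for sofic shifts $Y \subset \Sigma^{\mathbb{N}}$, $Z \subset (\Sigma^2)^{\mathbb{N}}$ such that $Z \cap Y^2$ is an equivalence relation on $Y$, with the words $x_{[0,m]}$ of length $m+1$ in place of the words $x_{[-m,m]}$ of length $2m+1$. -/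

import Mathlib

open Set Filter Topology
open scoped ENNReal

namespace SoficQuotient

open SymbolicDynamics.FullShift (shift)

section Subshifts

/-- `X ⊆ A^M` is a subshift of finite type: for some clopen set `C` of configurations, `X` consists
of the configurations no translate of which lies in `C`. -/
def IsSFT {M A : Type*} [AddMonoid M] [TopologicalSpace A] (X : Set (M → A)) : Prop :=
  ∃ C : Set (M → A), IsClopen C ∧ ∀ x, x ∈ X ↔ ∀ m : M, shift m x ∉ C

/-- `Y ⊆ A^M` is a sofic shift: it is the image of a subshift of finite type `X`, over some finite
alphabet, under a block map, i.e. a continuous map on `X` that commutes with all translations. -/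
def IsSofic {M A : Type*} [AddMonoid M] [TopologicalSpace A] (Y : Set (M → A)) : Prop :=
  ∃ (n : ℕ) (X : Set (M → Fin n)) (f : X → (M → A)), IsSFT X ∧ Continuous f ∧
    (∀ (m : M) (x x' : X), (x' : M → Fin n) = shift m (x : M → Fin n) → f x' = shift m (f x)) ∧
    range f = Y

/-- The binary relation on `Y ⊆ A^M` given by `Z ⊆ (A × A)^M`, through the identification of
`(A × A)^M` with `A^M × A^M`. -/
def rel {M A : Type*} (Y : Set (M → A)) (Z : Set (M → A × A)) (x y : Y) : Prop :=
  (fun m => ((x : M → A) m, (y : M → A) m)) ∈ Z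

/-- The formal quotient of `Y ⊆ A^M` by `Z ⊆ (A × A)^M` is sofic/sofic: `Y` and `Z` are sofic
shifts, and `Z ∩ Y²` is an equivalence relation on `Y`. -/
structure IsSoficPerSofic {M A : Type*} [AddMonoid M] [TopologicalSpace A]
    (Y : Set (M → A)) (Z : Set (M → A × A)) : Prop where
  sofic_left : IsSofic Y
  sofic_right : IsSofic Z
  equivalence : Equivalence (rel Y Z)

end Subshifts

section Words

/-- The positions `-m, …, m` of `ℤ`, in order. -/
def centered (m : ℕ) : List ℤ := (List.range (2 * m + 1)).map fun i => (i : ℤ) - (m : ℤ)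

/-- The positions `0, …, m` of `ℕ`, in order. -/
def initial (m : ℕ) : List ℕ := List.range (m + 1)

/-- The word that is read in `x` in the window `win m`: it is `x_{[-m,m]}` for the windows
`centered`, and `x_{[0,m]}` for the windows `initial`. -/
def word {M A : Type*} (win : ℕ → List M) (m : ℕ) (x : M → A) : List A := (win m).map x

/-- The words of `Y` in the window `win m`. -/
def Words {M A : Type*} (win : ℕ → List M) (Y : Set (M → A)) (m : ℕ) : Type _ :=
  {u : List A // ∃ x : Y, word win m (x : M → A) = u}

/-- The word of a point of `Y`, as a word of `Y`. -/
def wordOf {M A : Type*} (win : ℕ → List M) {Y : Set (M → A)} (m : ℕ) (x : Y) : Words win Y m :=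
  ⟨word win m (x : M → A), x, rfl⟩

/-- The graph on the words of `Y` in the window `win m`, where (distinct) `u` and `v` are adjacent
if and only if `[u] × [v]` meets `Z`. The self-loops, which this graph has at all words since `Z`
is reflexive on `Y`, are taken care of in `pathDist`. -/
def wordGraph {M A : Type*} (win : ℕ → List M) (Y : Set (M → A)) (Z : Set (M → A × A)) (m : ℕ) :
    SimpleGraph (Words win Y m) :=
  SimpleGraph.fromRel fun u v => ∃ x y : Y, wordOf win m x = u ∧ wordOf win m y = v ∧ rel Y Z x y

/-- The path metric `d_m`: the least length of a path of length at least `1` from `u` to `v`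
(`∞` if there is none), where self-loops may be used, so that `d_m(u, u) = 1`. -/
noncomputable def pathDist {M A : Type*} (win : ℕ → List M) (Y : Set (M → A)) (Z : Set (M → A × A))
    (m : ℕ) (u v : Words win Y m) : ℝ≥0∞ :=
  ((max 1 ((wordGraph win Y Z m).edist u v) : ℕ∞) : ℝ≥0∞)

end Words

section Metrics

/-- `d` is a pseudometric, where the value `∞` is allowed. -/
structure IsPseudometric {X : Type*} (d : X → X → ℝ≥0∞) : Prop where
  self : ∀ x, d x x = 0
  symm : ∀ x y, d x y = d y x
  triangle : ∀ x y z, d x z ≤ d x y + d y z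

/-- The pseudometrics `d` on `Y` such that `d(x, y) ≤ d_{cn}(x_{[-cn,cn]}, y_{[-cn,cn]}) / 2^{n-1}`
for all `n` (with `x_{[0,cn]}` and `y_{[0,cn]}` if the windows are `initial`). -/
def boundedPseudometrics {M A : Type*} (win : ℕ → List M) (Y : Set (M → A)) (Z : Set (M → A × A))
    (c : ℕ) : Set (Y → Y → ℝ≥0∞) :=
  {d | IsPseudometric d ∧ ∀ (n : ℕ) (x y : Y),
    d x y ≤ pathDist win Y Z (c * n) (wordOf win (c * n) x) (wordOf win (c * n) y) /
      (2 : ℝ≥0∞) ^ ((n : ℤ) - 1)}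

/-- `d` metrizes `Y/Z`: it induces a metric (with `∞` allowed as a value) on the set of equivalence
classes, and the topology of that metric is the quotient topology. -/
def Metrizes {M A : Type*} [TopologicalSpace A] {Y : Set (M → A)} {Z : Set (M → A × A)}
    (h : Equivalence (rel Y Z)) (d : Y → Y → ℝ≥0∞) : Prop :=
  ∃ E : EMetricSpace (Quotient (Setoid.mk (rel Y Z) h)),
    (∀ x y : Y, E.edist (Quotient.mk (Setoid.mk (rel Y Z) h) x)
      (Quotient.mk (Setoid.mk (rel Y Z) h) y) = d x y) ∧
    E.toUniformSpace.toTopologicalSpace =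
      (inferInstance : TopologicalSpace (Quotient (Setoid.mk (rel Y Z) h)))

end Metrics

section Computability

/-- The positive rational number `(a + 1) / (b + 1)` given by `(a, b)`. -/
noncomputable def posRat (e : ℕ × ℕ) : ℝ≥0∞ := ((e.1 : ℝ≥0∞) + 1) / ((e.2 : ℝ≥0∞) + 1)

/-- The element of `ℚ_{≥0} ∪ {∞}` given by `q`: the rational number `a / (b + 1)` for
`q = some (a, b)`, and `∞` for `q = none`. -/
noncomputable def extRat : Option (ℕ × ℕ) → ℝ≥0∞
  | none => ⊤
  | some (a, b) => (a : ℝ≥0∞) / ((b : ℝ≥0∞) + 1)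

/-- `F(x, y, i)` is computable, uniformly in `x`, `y` and `i`, where the points `x` and `y` of `Y`
are given as oracles: there is an algorithm `φ` which is run on the words of `x` and `y` in the
windows number `0, 1, 2, …` (and on `i`), which for some window gives an answer (and `none` until
then), and whose first answer is `F(x, y, i)`. -/
def ComputableOnPoints {M A I O : Type*} [Primcodable A] [Primcodable I] [Primcodable O]
    (win : ℕ → List M) {Y : Set (M → A)} (F : Y → Y → I → O) : Prop :=
  ∃ φ : (List A × List A) × I → Option O, Computable φ ∧ ∀ (x y : Y) (i : I), ∃ N : ℕ,
    φ ((word win N (x : M → A), word win N (y : M → A)), i) = some (F x y i) ∧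
    ∀ N' < N, φ ((word win N' (x : M → A), word win N' (y : M → A)), i) = none

/-- `d` is upper semicomputable: from `x`, `y` and `m` one can compute the terms `s_m` of a
decreasing sequence in `ℚ_{≥0} ∪ {∞}` with limit `d(x, y)`. -/
def UpperSemicomputable {M A : Type*} [Primcodable A] (win : ℕ → List M) {Y : Set (M → A)}
    (d : Y → Y → ℝ≥0∞) : Prop :=
  ∃ s : Y → Y → ℕ → Option (ℕ × ℕ), ComputableOnPoints win s ∧
    ∀ x y : Y, Antitone (fun m => extRat (s x y m)) ∧
      Tendsto (fun m => extRat (s x y m)) atTop (𝓝 (d x y))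

/-- From `x`, `y` and a rational `ε > 0` one can compute an `r` with `d(x, y) ∈ [r, 5/2 r + ε]`. -/
def ComputablyApproximable {M A : Type*} [Primcodable A] (win : ℕ → List M) {Y : Set (M → A)}
    (d : Y → Y → ℝ≥0∞) : Prop :=
  ∃ r : Y → Y → ℕ × ℕ → Option (ℕ × ℕ), ComputableOnPoints win r ∧
    ∀ (x y : Y) (e : ℕ × ℕ),
      d x y ∈ Icc (extRat (r x y e)) (5 / 2 * extRat (r x y e) + posRat e)

end Computability

end SoficQuotient

open SoficQuotient

/-! Call two points of `Y` near at level `n` if their words in the window `c * n` are words of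
related points. By the triangle inequality along paths of the word graphs, the required bounds say
exactly that points near at level `n` have distance at most `2^{1-n}`. The greatest pseudometric
with this property is the infimum of the costs of chains of near steps, where a step of level `n`
costs `2^{1-n}`.

The dynamical input is that, for a suitable `c`, five steps of level `n + 1` make one step of level
`n` (`exists_near_of_chain`). The related pairs are the label sequences of paths in a finite graph,
so five near steps give five such paths. By the pigeonhole principle all five can be made periodic
outside the small window simultaneously, using only positions of the large window. Consecutive
points that agreed on the large window then agree everywhere, and transitivity of the relation
applies.

As in the metrization lemma for uniformities, a chain of cost below `2^{1-n}` can be shortcut to one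
step of level `n` (`IsContracting.of_cost_lt`). Hence the distance is zero iff the points are near
at all levels, iff they are related, because `Z` is closed. The metric topology is Hausdorff and
coarser than the compact quotient topology, so the two coincide.

That shortcut needs only three steps; five are needed for large distances. A chain of cost below 3
without steps of level 0 is a single step of level 0 (`IsContracting.of_cost_lt_three`), so a chain
of cost at least 1 can be replaced by one with levels 0 and 1 only, at no more than 5/2 of the cost
(`IsContracting.exists_coarseChain`). Such coarse chains depend on a bounded window, and a finite
table lists their costs. Small distances are determined up to a factor 2 by the last level at which
the points are near, which a finite automaton decides. Enumerating chains of words gives the upper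
approximations. -/

namespace SoficQuotient

open SymbolicDynamics.FullShift (shift)

/-! ### Sofic shifts as label sequences of paths in finite graphs -/

section Presentations

/-- `r` is a path, indexed by `M`, in the graph with edge relation `T`. -/
def IsPath {M Q : Type*} [Add M] [One M] (T : Q → Q → Prop) (r : M → Q) : Prop :=
  ∀ t, T (r t) (r (t + 1))

/-- `S` consists of the labels of the paths of the vertex-labelled graph `(T, lab)`. -/
def IsPresentation {M B Q : Type*} [Add M] [One M] (T : Q → Q → Prop) (lab : Q → B)
    (S : Set (M → B)) : Prop :=
  ∀ x, x ∈ S ↔ ∃ r : M → Q, IsPath T r ∧ ∀ t, lab (r t) = x t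

/-- Every finite set of positions lies in an interval with an invertible left end. -/
def HasIntervals (M : Type*) [AddCommMonoidWithOne M] : Prop :=
  ∀ F : Finset M, ∃ (a b : M) (k : ℕ), a + b = 0 ∧ ∀ t ∈ F, ∃ i ≤ k, t = a + (i : M)

/-- A continuous map from a compact set of configurations to a discrete space depends on finitely
many coordinates only. -/
theorem exists_finset_forall_eq {M A B : Type*} [TopologicalSpace A] [DiscreteTopology A]
    [TopologicalSpace B] [DiscreteTopology B] {K : Set (M → A)} (hK : IsCompact K) {g : K → B}
    (hg : Continuous g) :
    ∃ F : Finset M, ∀ x x' : K, (∀ t ∈ F, (x : M → A) t = (x' : M → A) t) → g x = g x' := by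
  have hloc : ∀ x : K, ∃ F : Finset M,
      ∀ x' : K, (∀ t ∈ F, (x' : M → A) t = (x : M → A) t) → g x' = g x := by
    intro x
    have ho : IsOpen (g ⁻¹' {g x}) := (isOpen_discrete _).preimage hg
    obtain ⟨U, hU, hUg⟩ := isOpen_induced_iff.1 ho
    have hxU : (x : M → A) ∈ U := by
      have : x ∈ (Subtype.val ⁻¹' U : Set K) := by rw [hUg]; rfl
      exact this
    obtain ⟨I, u, hu, hsub⟩ := isOpen_pi_iff.1 hU _ hxU
    refine ⟨I, fun x' hx' => ?_⟩
    have : x' ∈ (Subtype.val ⁻¹' U : Set K) := hsub fun i hi => by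
      rw [hx' i hi]; exact (hu i hi).2
    rw [hUg] at this
    exact this
  choose I hI using hloc
  have : CompactSpace K := isCompact_iff_compactSpace.1 hK
  have hn : ∀ x : K, {x' : K | ∀ t ∈ I x, (x' : M → A) t = (x : M → A) t} ∈ 𝓝 x := by
    intro x
    refine IsOpen.mem_nhds ?_ (fun t _ => rfl : ∀ t ∈ I x, (x : M → A) t = (x : M → A) t)
    have : {x' : K | ∀ t ∈ I x, (x' : M → A) t = (x : M → A) t} =
        ⋂ t ∈ I x, {x' : K | (x' : M → A) t = (x : M → A) t} := by
      ext; simp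
    rw [this]
    refine isOpen_biInter_finset fun t _ => ?_
    exact (isOpen_discrete {(x : M → A) t}).preimage
      ((continuous_apply (A := fun _ : M => A) t).comp continuous_subtype_val)
  obtain ⟨s, -, hs⟩ := isCompact_univ.elim_nhds_subcover _ (fun x _ => hn x)
  classical
  refine ⟨s.biUnion I, fun x x' hxx' => ?_⟩
  obtain ⟨y, hy, hxy⟩ := mem_iUnion₂.1 (hs (mem_univ x))
  rw [hI y x hxy, hI y x']
  intro t ht
  rw [← hxx' t (Finset.mem_biUnion.2 ⟨y, hy, ht⟩), hxy t ht]

theorem IsSFT.isClosed {M A : Type*} [AddMonoid M] [TopologicalSpace A] {X : Set (M → A)}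
    (h : IsSFT X) : IsClosed X := by
  obtain ⟨C, hC, hX⟩ := h
  have : X = ⋂ m : M, (shift m) ⁻¹' Cᶜ := by
    ext x; simp [hX]
  rw [this]
  refine isClosed_iInter fun m => hC.compl.1.preimage ?_
  exact continuous_pi fun t => continuous_apply _

theorem IsSFT.shift_mem {M A : Type*} [AddMonoid M] [TopologicalSpace A] {X : Set (M → A)}
    (h : IsSFT X) {x : M → A} (hx : x ∈ X) (t : M) : shift t x ∈ X := by
  obtain ⟨C, -, hX⟩ := h
  rw [hX] at hx ⊢
  intro m
  have : shift m (shift t x) = shift (t + m) x := by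
    ext i; simp [add_assoc]
  rw [this]
  exact hx _

theorem IsSofic.isCompact {M A : Type*} [AddMonoid M] [TopologicalSpace A] {Y : Set (M → A)}
    (h : IsSofic Y) : IsCompact Y := by
  obtain ⟨n, X, f, hX, hf, -, rfl⟩ := h
  have : CompactSpace X := isCompact_iff_compactSpace.1 hX.isClosed.isCompact
  exact isCompact_range hf

/-- Higher block presentation: an interval is chosen that contains all coordinates on which the
forbidden clopen set and the symbol of the image at `0` depend. The states are the words of `X` on
this interval, and edges are overlaps. -/
theorem IsSofic.exists_isPresentation {M B : Type*} [AddCommMonoidWithOne M]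
    (hM : HasIntervals M) [TopologicalSpace B] [DiscreteTopology B] {S : Set (M → B)}
    (h : IsSofic S) :
    ∃ (Q : Type) (_ : Finite Q) (T : Q → Q → Prop) (lab : Q → B), IsPresentation T lab S := by
  classical
  obtain ⟨n, X, f, hX, hf, hcomm, rfl⟩ := h
  have hXs := fun {x} => hX.shift_mem (x := x)
  have hXc := hX.isClosed.isCompact
  obtain ⟨C, hC, hXC⟩ := hX
  obtain ⟨F₁, hF₁⟩ := exists_finset_forall_eq hXc
    ((continuous_apply (0 : M)).comp hf)
  have hind : Continuous fun x : (univ : Set (M → Fin n)) => decide ((x : M → Fin n) ∈ C) := by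
    have : IsClopen ((fun x : (univ : Set (M → Fin n)) => decide ((x : M → Fin n) ∈ C)) ⁻¹'
        {true}) := by
      convert hC.preimage (continuous_subtype_val (p := fun x => x ∈ (univ : Set (M → Fin n))))
        using 1
      ext; simp
    exact (continuous_bool_rng true).2 this
  obtain ⟨F₂, hF₂⟩ := exists_finset_forall_eq isCompact_univ hind
  obtain ⟨a, b, k, hab, hk⟩ := hM (F₁ ∪ F₂)
  let rd : (M → Fin n) → (Fin (k + 1) → Fin n) := fun x i => x (a + ((i : ℕ) : M))
  have hrd : ∀ x x' : M → Fin n, rd x = rd x' → ∀ t ∈ F₁ ∪ F₂, x t = x' t := by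
    intro x x' hxx' t ht
    obtain ⟨i, hi, rfl⟩ := hk t ht
    exact congrFun hxx' ⟨i, by omega⟩
  have hf0 : ∀ x x' : X, rd x = rd x' → f x 0 = f x' 0 := fun x x' hxx' =>
    hF₁ x x' fun t ht => hrd _ _ hxx' t (Finset.mem_union_left _ ht)
  have hCC : ∀ x x' : M → Fin n, rd x = rd x' → x' ∉ C → x ∉ C := by
    intro x x' hxx' hx' hx
    have := hF₂ ⟨x, trivial⟩ ⟨x', trivial⟩ fun t ht =>
      hrd _ _ hxx' t (Finset.mem_union_right _ ht)
    simp [hx, hx'] at this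
  have hsh : ∀ (x : X) (t : M), f x t = f ⟨shift t x, hXs x.2 t⟩ 0 := by
    intro x t
    rw [hcomm t x ⟨shift t x, hXs x.2 t⟩ rfl]
    simp
  let Q := {q : Fin (k + 1) → Fin n // ∃ x : X, rd x = q}
  refine ⟨Q, inferInstance,
    fun q q' => ∀ i (hi : i < k), q.1 ⟨i + 1, by omega⟩ = q'.1 ⟨i, by omega⟩,
    fun q => f q.2.choose 0, fun y => ⟨?_, ?_⟩⟩
  · rintro ⟨x, rfl⟩
    refine ⟨fun t => ⟨rd (shift t x), ⟨shift t x, hXs x.2 t⟩, rfl⟩, fun t i hi => ?_, fun t => ?_⟩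
    · simp only [rd, SymbolicDynamics.FullShift.shift_apply]
      push_cast
      simp only [add_assoc, add_comm, add_left_comm]
    · rw [hsh x t]
      apply hf0
      exact (⟨⟨shift t x, hXs x.2 t⟩, rfl⟩ :
        ∃ x' : X, rd x' = rd (shift t (x : M → Fin n))).choose_spec
  · rintro ⟨r, hr, hy⟩
    have hr0 : ∀ i (hi : i < k + 1) (t : M), (r t).1 ⟨i, hi⟩ = (r (t + (i : M))).1 ⟨0, by omega⟩ := by
      intro i
      induction i with
      | zero => intro _ t; simp
      | succ i ih =>
        intro hi t
        rw [hr t i (by omega), ih]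
        rw [show t + 1 + (i : M) = t + ((i + 1 : ℕ) : M) by push_cast; abel]
    -- The state at `t` holds the letters at the positions `t + a, …, t + a + k`. The letter at `t`
    -- is therefore the first letter of the state at `t - a`, and `b` plays the role of `-a`, which
    -- need not make sense in `ℕ`.
    let x : M → Fin n := fun t => (r (t + b)).1 ⟨0, by omega⟩
    have hx : ∀ t, rd (shift t x) = (r t).1 := by
      intro t
      ext i
      rw [hr0 i i.2]
      simp only [rd, SymbolicDynamics.FullShift.shift_apply, x]
      rw [show t + (a + ((i : ℕ) : M)) + b = t + ((i : ℕ) : M) by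
        rw [← add_assoc, add_right_comm, add_assoc t a b, hab]; simp]
    have hxX : x ∈ X := by
      rw [hXC]
      intro m
      apply hCC _ ((r m).2.choose : M → Fin n)
      · rw [hx]; exact (r m).2.choose_spec.symm
      · have h1 := (hXC _).1 (r m).2.choose.2 0
        have h2 : shift (0 : M) ((r m).2.choose : M → Fin n) = (r m).2.choose := by
          ext; simp
        rwa [h2] at h1
    refine ⟨⟨x, hxX⟩, ?_⟩
    ext t
    rw [hsh, ← hy]
    apply hf0
    rw [(r t).2.choose_spec]
    exact hx t

end Presentations

/-! ### Pumping and extending paths over the windows of `ℕ` and `ℤ` -/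

section Windows

/-- Every sequence of letters can be made eventually periodic, without changing its first `a`
letters, by a change of the positions that uses only the first positions. -/
theorem exists_fold {R : Type*} [Finite R] (a : ℕ) (r : ℕ → R) :
    ∃ φ : ℕ → ℕ, (∀ t, r (φ (t + 1)) = r (φ t + 1)) ∧ (∀ t ≤ a, φ t = t) ∧
      ∀ t, φ t ≤ a + Nat.card R := by
  obtain ⟨i, j, hai, hij, hj, hr⟩ :
      ∃ i j, a ≤ i ∧ i < j ∧ j ≤ a + Nat.card R ∧ r i = r j := by
    have hni : ¬ Function.Injective fun i : Fin (Nat.card R + 1) => r (a + i) := fun h => by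
      simpa using Nat.card_le_card_of_injective _ h
    obtain ⟨p, q, hpq, hne⟩ := Function.not_injective_iff.1 hni
    rcases lt_or_gt_of_ne hne with h | h
    · exact ⟨a + p, a + q, by omega, by have := Fin.lt_def.1 h; omega, by omega, hpq⟩
    · exact ⟨a + q, a + p, by omega, by have := Fin.lt_def.1 h; omega, by omega, hpq.symm⟩
  -- The positions run up to `j - 1` and then cycle through `i, …, j - 1`. The jump from `j - 1` to
  -- `i` respects transitions because `r i = r j`.
  let φ : ℕ → ℕ := Nat.rec 0 fun _ p => if p + 1 = j then i else p + 1
  have hφ : ∀ t, φ (t + 1) = if φ t + 1 = j then i else φ t + 1 := fun _ => rfl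
  have hlt : ∀ t, φ t < j := by
    intro t
    induction t with
    | zero => exact show 0 < j by omega
    | succ t ih => rw [hφ]; split_ifs <;> omega
  have hid : ∀ t < j, φ t = t := by
    intro t
    induction t with
    | zero => intro _; rfl
    | succ t ih => intro h; rw [hφ, ih (by omega), if_neg (by omega)]
  refine ⟨φ, fun t => ?_, fun t ht => hid t (by omega), fun t => (hlt t).le.trans hj⟩
  rw [hφ]
  split_ifs with h
  · rw [h, hr]
  · rfl

/-- A finite path whose last vertex starts an infinite path extends to an infinite path. -/
theorem exists_path_of_isChain {Q : Type*} (T : Q → Q → Prop) (l : List Q) (hl : l.IsChain T)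
    (q : Q) (hq : q ∈ l.getLast?) (hF : ∃ r : ℕ → Q, IsPath T r ∧ r 0 = q) :
    ∃ r : ℕ → Q, IsPath T r ∧ (List.range l.length).map r = l := by
  induction l with
  | nil => simp at hq
  | cons p l ih =>
    cases l with
    | nil =>
      simp only [List.getLast?_singleton, Option.mem_some_iff] at hq
      obtain ⟨r, hr, hr0⟩ := hF
      exact ⟨r, hr, by simp [hr0, hq]⟩
    | cons p' l =>
      obtain ⟨r, hr, hrl⟩ := ih (List.IsChain.tail hl) (by simpa using hq)
      refine ⟨fun t => Nat.casesOn t p r, fun t => ?_, ?_⟩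
      · cases t with
        | zero =>
          have h0 : r 0 = p' := by
            rw [List.length_cons, List.range_succ_eq_map] at hrl
            simp only [List.map_cons, List.cons.injEq] at hrl
            exact hrl.1
          show T p (r 0)
          rw [h0]
          exact (List.isChain_cons_cons.1 hl).1
        | succ t => exact hr t
      · rw [List.length_cons, List.range_succ_eq_map, List.map_cons, List.map_map]
        congr 1

theorem isChain_map_range {Q : Type*} {T : Q → Q → Prop} {r : ℕ → Q} (hr : IsPath T r) (n : ℕ) :
    ((List.range n).map r).IsChain T := by
  rw [List.isChain_iff_getElem]
  intro i hi
  simpa using hr i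

/-- The path indexed by `ℤ` with a given right half and a given left half. -/
def glue {Q : Type*} (r s : ℕ → Q) : ℤ → Q
  | Int.ofNat n => r n
  | Int.negSucc n => s n

theorem isPath_glue {Q : Type*} {T : Q → Q → Prop} {r s : ℕ → Q} (hr : IsPath T r)
    (hs : ∀ t, T (s (t + 1)) (s t)) (h0 : T (s 0) (r 0)) : IsPath T (glue r s) := by
  intro t
  rcases t with n | n
  · exact hr n
  · cases n with
    | zero => exact h0
    | succ n =>
      have : Int.negSucc (n + 1) + 1 = Int.negSucc n := by omega
      rw [this]
      exact hs n

/-- The properties of the windows `centered` and `initial` which are used. -/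
structure IsWindows {M : Type*} [AddCommMonoidWithOne M] (win : ℕ → List M) : Prop where
  intervals : HasIntervals M
  exhaust : ∀ t, ∃ m, t ∈ win m
  pump : ∀ (R : Type) [Finite R], ∃ c : ℕ, 1 ≤ c ∧ ∀ (n : ℕ) (r : M → R), ∃ φ : M → M,
    (∀ t, ∃ s, r (φ t) = r s ∧ r (φ (t + 1)) = r (s + 1)) ∧ (∀ t ∈ win (c * n), φ t = t) ∧
    ∀ t, φ t ∈ win (c * (n + 1))
  extend : ∀ {Q : Type} (T : Q → Q → Prop), ∃ I F : Set Q, ∀ (m : ℕ) (l : List Q),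
    (∃ r : M → Q, IsPath T r ∧ (win m).map r = l) ↔
      l.length = (win m).length ∧ l.IsChain T ∧ (∃ q ∈ l.head?, q ∈ I) ∧ ∃ q ∈ l.getLast?, q ∈ F
  length_strictMono : StrictMono fun m => (win m).length
  length_primrec : Primrec fun m => (win m).length
  trunc : ∃ off : ℕ → ℕ → ℕ, Primrec₂ off ∧
    ∀ m N, m ≤ N → win m = ((win N).drop (off m N)).take (win m).length

theorem initial_isWindows : IsWindows initial where
  intervals F := ⟨0, 0, F.sup id, by simp, fun t ht => ⟨t, Finset.le_sup (f := id) ht, by simp⟩⟩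
  exhaust t := ⟨t, by simp [initial]⟩
  pump R _ := by
    -- Folding overshoots the window by at most `Nat.card R`. The summand `1` keeps the constant
    -- positive when `R` is empty.
    refine ⟨Nat.card R + 1, by omega, fun n r => ?_⟩
    obtain ⟨φ, h1, h2, h3⟩ := exists_fold ((Nat.card R + 1) * n) r
    refine ⟨φ, fun t => ⟨φ t, rfl, h1 t⟩, fun t ht => h2 t ?_, fun t => ?_⟩
    · simp only [initial, List.mem_range] at ht; omega
    · have := h3 t
      simp only [initial, List.mem_range, mul_add]; omega
  extend {Q} T := by
    refine ⟨univ, {q | ∃ r : ℕ → Q, IsPath T r ∧ r 0 = q}, fun m l => ⟨?_, ?_⟩⟩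
    · rintro ⟨r, hr, rfl⟩
      refine ⟨by simp, isChain_map_range hr _, ⟨r 0, by simp [initial, List.range_succ_eq_map], trivial⟩, r m, ?_,
        fun t => r (m + t), fun t => hr (m + t), rfl⟩
      simp [initial, List.range_succ]
    · rintro ⟨hl, hc, -, q, hq, hF⟩
      obtain ⟨r, hr, hrl⟩ := exists_path_of_isChain T l hc q hq hF
      refine ⟨r, hr, ?_⟩
      rw [hl] at hrl
      simpa [initial] using hrl
  length_strictMono := by intro m n h; simpa [initial] using h
  length_primrec := by simpa [initial] using Primrec.succ
  trunc := by
    refine ⟨fun _ _ => 0, Primrec.const 0, fun m N h => ?_⟩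
    simp only [initial, List.drop_zero, List.length_range, List.take_range]
    congr 1
    omega

theorem centered_eq (m : ℕ) :
    centered m = (List.range (2 * m + 1)).map fun i : ℕ => (i : ℤ) - m := by
  simp only [centered, List.pure_def, List.bind_eq_flatMap, List.map_flatMap, List.map_cons,
    List.map_nil]
  exact List.flatMap_pure_eq_map _ _

theorem mem_centered {m : ℕ} {t : ℤ} : t ∈ centered m ↔ -(m : ℤ) ≤ t ∧ t ≤ m := by
  simp only [centered_eq, List.mem_map, List.mem_range]
  constructor
  · rintro ⟨i, hi, rfl⟩; omega
  · rintro ⟨h1, h2⟩; exact ⟨(t + m).toNat, by omega, by omega⟩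

theorem centered_isWindows : IsWindows centered where
  intervals F := by
    refine ⟨-(F.sup Int.natAbs : ℕ), (F.sup Int.natAbs : ℕ), 2 * F.sup Int.natAbs, by simp,
      fun t ht => ?_⟩
    have h : t.natAbs ≤ F.sup Int.natAbs := Finset.le_sup (f := Int.natAbs) ht
    refine ⟨(t + (F.sup Int.natAbs : ℕ)).toNat, by omega, ?_⟩
    simp only [Int.natCast_toNat_eq_self.2 (show 0 ≤ t + (F.sup Int.natAbs : ℕ) by omega)]
    omega
  exhaust t := ⟨t.natAbs, by rw [mem_centered]; omega⟩
  pump R _ := by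
    refine ⟨Nat.card R + 1, by omega, fun n r => ?_⟩
    obtain ⟨φ, h1, h2, h3⟩ := exists_fold ((Nat.card R + 1) * n) fun t : ℕ => r t
    obtain ⟨ψ, k1, k2, k3⟩ := exists_fold ((Nat.card R + 1) * n) fun t : ℕ => r (-t)
    refine ⟨glue (fun t => φ t) (fun t => -ψ (t + 1)), fun t => ?_, fun t ht => ?_, fun t => ?_⟩
    · rcases t with t | t
      · exact ⟨φ t, rfl, h1 t⟩
      -- The left half is folded in reverse, so that the right end of a transition is exact and the
      -- left end is only matched in value. This is why `pump` asks for some transition of `r` with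
      -- the same values, rather than for the one that starts at `φ t`.
      · refine ⟨-(ψ t : ℤ) - 1, ?_, ?_⟩
        · have := k1 t
          simp only [glue]
          rw [this]
          congr 1
          push_cast
          ring
        · cases t with
          | zero =>
            have h : Int.negSucc 0 + 1 = Int.ofNat 0 := rfl
            rw [h]
            simp [glue, h2 0 (by omega), k2 0 (by omega)]
          | succ t =>
            have : Int.negSucc (t + 1) + 1 = Int.negSucc t := by omega
            rw [this]
            simp [glue]
    · rw [mem_centered] at ht
      rcases t with t | t
      · simp only [Int.ofNat_eq_natCast] at ht
        simp only [glue, Int.ofNat_eq_natCast, Nat.cast_inj]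
        exact h2 t (by omega)
      · simp only [glue]
        rw [k2 (t + 1) (by omega)]
        omega
    · rw [mem_centered]
      rcases t with t | t
      · have := h3 t
        simp only [glue, mul_add]
        omega
      · have := k3 (t + 1)
        simp only [glue, mul_add]
        omega
  extend {Q} T := by
    -- A finite path extends to a bi-infinite one iff its first vertex has an infinite past and its
    -- last vertex an infinite future.
    refine ⟨{q | ∃ s : ℕ → Q, (∀ t, T (s (t + 1)) (s t)) ∧ T (s 0) q},
      {q | ∃ r : ℕ → Q, IsPath T r ∧ r 0 = q}, fun m l => ⟨?_, ?_⟩⟩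
    · rintro ⟨r, hr, rfl⟩
      have e : (centered m).map r = (List.range (2 * m + 1)).map fun i : ℕ => r (i - m) := by
        simp [centered_eq, Function.comp_def]
      refine ⟨by simp, ?_, ⟨r (-m), by simp [e, List.range_succ_eq_map], fun t => r (-m - 1 - t), fun t => ?_, ?_⟩,
        r m, ?_, fun t => r (m + t), fun t => ?_, by simp⟩
      · rw [e]
        apply isChain_map_range
        intro t
        convert hr (t - m) using 2
        push_cast
        ring
      · convert hr _ using 2
        push_cast
        ring
      · convert hr _ using 2
        push_cast
        ring
      · rw [e, List.range_succ]
        simp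
        congr 1
        ring
      · convert hr _ using 2
        push_cast
        ring
    · rintro ⟨hl, hc, ⟨p, hp, s, hs, hsp⟩, q, hq, hF⟩
      obtain ⟨r, hr, hrl⟩ := exists_path_of_isChain T l hc q hq hF
      have hr0 : r 0 = p := by
        rw [← hrl, hl] at hp
        simpa [centered_eq, List.range_succ_eq_map] using hp
      have hg := isPath_glue hr hs (hr0 ▸ hsp)
      refine ⟨fun t => glue r s (t + m), fun t => ?_, ?_⟩
      · convert hg _ using 2
        ring
      · rw [hl] at hrl
        rw [← hrl]
        simp only [centered_eq, List.map_map, List.length_map, List.length_range]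
        refine List.map_congr_left fun a _ => ?_
        simp [glue]
  length_strictMono := by intro m n h; simpa [centered_eq] using h
  length_primrec := by
    simpa [centered_eq] using Primrec.succ.comp (Primrec.nat_mul.comp (Primrec.const 2) Primrec.id)
  trunc := by
    refine ⟨fun m N => N - m, Primrec.nat_sub.comp Primrec.snd Primrec.fst, fun m N h => ?_⟩
    apply List.ext_getElem
    · simp [centered_eq]; omega
    · intro i h1 h2
      simp [centered_eq] at h1 ⊢
      omega

end Windows

/-! ### Near points, and the contraction property -/

section Near

/-- The pairs of points of `Y` that are related by `Z`, as a subset of `(A × A)^M`. -/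
def relatedPairs {M A : Type*} (Y : Set (M → A)) (Z : Set (M → A × A)) : Set (M → A × A) :=
  {z | (fun t => (z t).1) ∈ Y ∧ (fun t => (z t).2) ∈ Y ∧ z ∈ Z}

/-- Fibre product of two presentations of `Y` with one of `Z`. Membership of both coordinates in `Y`
is recorded along with `Z`, so that it survives pumping. -/
theorem IsSoficPerSofic.exists_isPresentation {M A : Type*} [AddCommMonoidWithOne M]
    (hM : HasIntervals M) [TopologicalSpace A] [DiscreteTopology A] {Y : Set (M → A)}
    {Z : Set (M → A × A)} (h : IsSoficPerSofic Y Z) :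
    ∃ (Q : Type) (_ : Finite Q) (T : Q → Q → Prop) (lab : Q → A × A),
      IsPresentation T lab (relatedPairs Y Z) := by
  obtain ⟨Q₁, _, T₁, lab₁, h₁⟩ := h.sofic_left.exists_isPresentation hM
  obtain ⟨Q₂, _, T₂, lab₂, h₂⟩ := h.sofic_right.exists_isPresentation hM
  refine ⟨{q : Q₁ × Q₁ × Q₂ // lab₂ q.2.2 = (lab₁ q.1, lab₁ q.2.1)}, inferInstance,
    fun p q => T₁ p.1.1 q.1.1 ∧ T₁ p.1.2.1 q.1.2.1 ∧ T₂ p.1.2.2 q.1.2.2, fun q => lab₂ q.1.2.2,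
    fun z => ⟨?_, ?_⟩⟩
  · rintro ⟨hx, hy, hz⟩
    obtain ⟨r, hr, hr'⟩ := (h₁ _).1 hx
    obtain ⟨s, hs, hs'⟩ := (h₁ _).1 hy
    obtain ⟨u, hu, hu'⟩ := (h₂ _).1 hz
    exact ⟨fun t => ⟨(r t, s t, u t), by simp [hr', hs', hu']⟩,
      fun t => ⟨hr t, hs t, hu t⟩, fun t => hu' t⟩
  · rintro ⟨r, hr, hz⟩
    refine ⟨(h₁ _).2 ⟨fun t => (r t).1.1, fun t => (hr t).1, fun t => ?_⟩,
      (h₁ _).2 ⟨fun t => (r t).1.2.1, fun t => (hr t).2.1, fun t => ?_⟩,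
      (h₂ _).2 ⟨fun t => (r t).1.2.2, fun t => (hr t).2.2, hz⟩⟩
    · simp [← hz t, (r t).2]
    · simp [← hz t, (r t).2]

variable {M A : Type*}

/-- The words of `x` and `y` in the window `win m` are words of related points. -/
def Near (win : ℕ → List M) (Y : Set (M → A)) (Z : Set (M → A × A)) (m : ℕ) (x y : Y) : Prop :=
  ∃ x' y' : Y, wordOf win m x' = wordOf win m x ∧ wordOf win m y' = wordOf win m y ∧
    rel Y Z x' y'

theorem wordOf_eq_iff {win : ℕ → List M} {Y : Set (M → A)} {m : ℕ} {x y : Y} :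
    wordOf win m x = wordOf win m y ↔ ∀ t ∈ win m, (x : M → A) t = (y : M → A) t := by
  exact Subtype.ext_iff.trans List.map_inj_left

theorem Near.symm {win : ℕ → List M} {Y : Set (M → A)} {Z : Set (M → A × A)}
    (h : Equivalence (rel Y Z)) {m : ℕ} {x y : Y} (hxy : Near win Y Z m x y) :
    Near win Y Z m y x := by
  obtain ⟨x', y', hx, hy, hr⟩ := hxy
  exact ⟨y', x', hy, hx, h.symm hr⟩

theorem Near.refl {win : ℕ → List M} {Y : Set (M → A)} {Z : Set (M → A × A)}
    (h : Equivalence (rel Y Z)) {m : ℕ} (x : Y) : Near win Y Z m x x :=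
  ⟨x, x, rfl, rfl, h.refl x⟩

theorem Near.of_rel {win : ℕ → List M} {Y : Set (M → A)} {Z : Set (M → A × A)} {m : ℕ} {x y : Y}
    (h : rel Y Z x y) : Near win Y Z m x y :=
  ⟨x, y, rfl, rfl, h⟩

theorem near_congr {win : ℕ → List M} {Y : Set (M → A)} {Z : Set (M → A × A)} {m : ℕ}
    {x y x' y' : Y} (hx : wordOf win m x = wordOf win m x') (hy : wordOf win m y = wordOf win m y') :
    Near win Y Z m x y ↔ Near win Y Z m x' y' := by
  simp only [Near, hx, hy]

theorem IsWindows.subset [AddCommMonoidWithOne M] {win : ℕ → List M} (hw : IsWindows win) {m N : ℕ}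
    (h : m ≤ N) : win m ⊆ win N := by
  obtain ⟨off, -, ho⟩ := hw.trunc
  intro t ht
  rw [ho m N h] at ht
  exact List.mem_of_mem_drop (List.mem_of_mem_take ht)

theorem wordOf_eq_of_le [AddCommMonoidWithOne M] {win : ℕ → List M} (hw : IsWindows win)
    {Y : Set (M → A)} {m N : ℕ} (h : m ≤ N) {x y : Y} (hxy : wordOf win N x = wordOf win N y) :
    wordOf win m x = wordOf win m y := by
  rw [wordOf_eq_iff] at *
  exact fun t ht => hxy t (hw.subset h ht)

theorem Near.mono [AddCommMonoidWithOne M] {win : ℕ → List M} (hw : IsWindows win)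
    {Y : Set (M → A)} {Z : Set (M → A × A)} {m N : ℕ} (h : m ≤ N) {x y : Y}
    (hxy : Near win Y Z N x y) : Near win Y Z m x y := by
  obtain ⟨x', y', hx, hy, hr⟩ := hxy
  exact ⟨x', y', wordOf_eq_of_le hw h hx, wordOf_eq_of_le hw h hy, hr⟩

/-- Finite chains of near points in large windows join points which are near in small ones. -/
theorem exists_near_of_chain [AddCommMonoidWithOne M] {win : ℕ → List M} (hw : IsWindows win)
    [TopologicalSpace A] [DiscreteTopology A] {Y : Set (M → A)} {Z : Set (M → A × A)}
    (h : IsSoficPerSofic Y Z) (K : ℕ) :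
    ∃ c : ℕ, 1 ≤ c ∧ ∀ (n : ℕ) (x : ℕ → Y),
      (∀ i < K, Near win Y Z (c * (n + 1)) (x i) (x (i + 1))) →
        Near win Y Z (c * n) (x 0) (x K) := by
  obtain ⟨Q, _, T, lab, hP⟩ := h.exists_isPresentation hw.intervals
  obtain ⟨c, hc, hpump⟩ := hw.pump (Fin K → Q)
  refine ⟨c, hc, fun n x hx => ?_⟩
  obtain _ | K := K
  · exact Near.refl h.equivalence _
  have hx' : ∀ i : Fin (K + 1), Near win Y Z (c * (n + 1)) (x i) (x (i + 1)) := fun i => hx i i.2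
  choose p q hp hq hpq using hx'
  have hpath : ∀ i, ∃ r : M → Q, IsPath T r ∧
      ∀ t, lab (r t) = ((p i : M → A) t, (q i : M → A) t) :=
    fun i => (hP _).1 ⟨(p i).2, (q i).2, hpq i⟩
  choose r hr hlab using hpath
  -- The `K` paths are pumped as one path of tuples of states, so that the same `φ` serves for all
  -- of them.
  obtain ⟨φ, h1, h2, h3⟩ := hpump n fun t i => r i t
  have hrel : ∀ i, (fun t => ((p i : M → A) (φ t), (q i : M → A) (φ t))) ∈ relatedPairs Y Z := by
    intro i
    refine (hP _).2 ⟨fun t => r i (φ t), fun t => ?_, fun t => hlab i (φ t)⟩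
    obtain ⟨s, hs, hs'⟩ := h1 t
    beta_reduce
    rw [show r i (φ t) = r i s from congrFun hs i,
      show r i (φ (t + 1)) = r i (s + 1) from congrFun hs' i]
    exact hr i s
  let p' : Fin (K + 1) → Y := fun i => ⟨fun t => (p i : M → A) (φ t), (hrel i).1⟩
  let q' : Fin (K + 1) → Y := fun i => ⟨fun t => (q i : M → A) (φ t), (hrel i).2.1⟩
  have hstep : ∀ i, rel Y Z (p' i) (q' i) := fun i => (hrel i).2.2
  -- Both points agree with `x (i + 1)` on the large window, and `φ` takes all its values there;
  -- after folding they are equal, not merely near.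
  have heq : ∀ i (hi : i + 1 < K + 1), q' ⟨i, by omega⟩ = p' ⟨i + 1, hi⟩ := by
    intro i hi
    ext t
    have e1 := wordOf_eq_iff.1 (hq ⟨i, by omega⟩) (φ t) (h3 t)
    have e2 := wordOf_eq_iff.1 (hp ⟨i + 1, hi⟩) (φ t) (h3 t)
    exact e1.trans e2.symm
  have hall : ∀ i (hi : i < K + 1), rel Y Z (p' 0) (q' ⟨i, hi⟩) := by
    intro i
    induction i with
    | zero => intro _; exact hstep 0
    | succ i ih =>
      intro hi
      have := ih (by omega)
      rw [heq i hi] at this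
      exact h.equivalence.trans this (hstep _)
  refine ⟨p' 0, q' ⟨K, by omega⟩, ?_, ?_, hall K (by omega)⟩
  · rw [wordOf_eq_iff]
    intro t ht
    have ht' := h3 t
    have e := wordOf_eq_iff.1 (hp 0) (φ t) ht'
    rw [h2 t ht] at e
    simpa [p', h2 t ht] using e
  · rw [wordOf_eq_iff]
    intro t ht
    have ht' := h3 t
    have e := wordOf_eq_iff.1 (hq ⟨K, by omega⟩) (φ t) ht'
    rw [h2 t ht] at e
    simpa [q', h2 t ht] using e

/-- The related witnesses converge to `(x, y)` because the windows exhaust `M`, and `Z` is closed,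
being compact. -/
theorem rel_of_forall_near [AddCommMonoidWithOne M] {win : ℕ → List M} (hw : IsWindows win)
    [TopologicalSpace A] [DiscreteTopology A] {Y : Set (M → A)} {Z : Set (M → A × A)}
    (h : IsSoficPerSofic Y Z) {c : ℕ} (hc : 1 ≤ c) {x y : Y}
    (hxy : ∀ n, Near win Y Z (c * n) x y) : rel Y Z x y := by
  choose p q hp hq hpq using hxy
  refine h.sofic_right.isCompact.isClosed.mem_of_tendsto
    (f := fun n t => ((p n : M → A) t, (q n : M → A) t)) (b := atTop) ?_
    (Eventually.of_forall hpq)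
  rw [tendsto_pi_nhds]
  intro t
  obtain ⟨m, hm⟩ := hw.exhaust t
  refine tendsto_const_nhds.congr' ?_
  filter_upwards [eventually_ge_atTop m] with n hn
  have ht : t ∈ win (c * n) := hw.subset (hn.trans (Nat.le_mul_of_pos_left n hc)) hm
  rw [wordOf_eq_iff.1 (hp n) t ht, wordOf_eq_iff.1 (hq n) t ht]

end Near

/-! ### From path metrics to bounds on near points -/

section WordGraph

variable {M A : Type*} {win : ℕ → List M} {Y : Set (M → A)} {Z : Set (M → A × A)}

/-- The bound `2^{1-n}` for the distance of points that are near in the window number `n`. -/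
noncomputable def weight (n : ℕ) : ℝ≥0∞ := 2 * 2⁻¹ ^ n

theorem div_two_zpow (a : ℝ≥0∞) (n : ℕ) : a / (2 : ℝ≥0∞) ^ ((n : ℤ) - 1) = a * weight n := by
  rw [weight, ENNReal.div_eq_inv_mul, mul_comm, ← ENNReal.zpow_neg, neg_sub,
    ENNReal.zpow_sub (by simp) (by simp), zpow_one, zpow_natCast, ENNReal.inv_pow]

theorem weight_ne_top (n : ℕ) : weight n ≠ ⊤ :=
  ENNReal.mul_ne_top (by simp) (ENNReal.pow_ne_top (by simp))

theorem weight_pos (n : ℕ) : 0 < weight n :=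
  ENNReal.mul_pos (by simp) (pow_ne_zero _ (by simp))

theorem wordGraph_adj_iff (h : Equivalence (rel Y Z)) {m : ℕ} {x y : Y} :
    (wordGraph win Y Z m).Adj (wordOf win m x) (wordOf win m y) ↔
      wordOf win m x ≠ wordOf win m y ∧ Near win Y Z m x y := by
  rw [wordGraph, SimpleGraph.fromRel_adj]
  refine and_congr_right fun _ => ⟨?_, Or.inl⟩
  rintro (h' | ⟨y', x', hy, hx, hr⟩)
  · exact h'
  · exact ⟨x', y', hx, hy, h.symm hr⟩

theorem le_length_mul_weight (h : Equivalence (rel Y Z)) {d : Y → Y → ℝ≥0∞}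
    (hd : IsPseudometric d) {m : ℕ} {w : ℝ≥0∞} (hn : ∀ x y, Near win Y Z m x y → d x y ≤ w)
    {u v : Words win Y m} (p : (wordGraph win Y Z m).Walk u v) :
    ∀ x y : Y, wordOf win m x = u → wordOf win m y = v → d x y ≤ max 1 (p.length : ℝ≥0∞) * w := by
  induction p with
  | nil =>
    rintro x y rfl hy
    simpa using hn x y ((near_congr rfl hy).2 (Near.refl h x))
  | @cons u u' v hadj p ih =>
    rintro x y rfl rfl
    obtain ⟨x', rfl⟩ : ∃ x', wordOf win m x' = u' := ⟨u'.2.choose, Subtype.ext u'.2.choose_spec⟩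
    have hxx' : Near win Y Z m x x' := ((wordGraph_adj_iff h).1 hadj).2
    rw [SimpleGraph.Walk.length_cons]
    -- On the last edge the target point can be replaced by `y`, since nearness depends only on
    -- words; the trivial walk that remains would otherwise be charged a second step.
    rcases Nat.eq_zero_or_pos p.length with h0 | h0
    · have hxy := (near_congr rfl (SimpleGraph.Walk.eq_of_length_eq_zero h0)).1 hxx'
      simpa [h0] using hn x y hxy
    · have := ih x' y rfl rfl
      rw [max_eq_right (by exact_mod_cast h0)] at this
      rw [max_eq_right (by simp)]
      calc d x y ≤ d x x' + d x' y := hd.triangle _ _ _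
        _ ≤ w + _ := add_le_add (hn _ _ hxx') this
        _ = _ := by push_cast; ring

/-- Near points are those whose words have path distance `1`. The bounds for longer paths follow by
the triangle inequality, and those for infinite path distance are void. -/
theorem mem_boundedPseudometrics_iff (h : Equivalence (rel Y Z)) {c : ℕ} {d : Y → Y → ℝ≥0∞} :
    d ∈ boundedPseudometrics win Y Z c ↔
      IsPseudometric d ∧ ∀ n x y, Near win Y Z (c * n) x y → d x y ≤ weight n := by
  refine and_congr_right fun hd => forall_congr' fun n => ?_
  simp only [div_two_zpow]
  constructor
  · intro hle x y hxy
    refine (hle x y).trans ?_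
    have h1 : (wordGraph win Y Z (c * n)).edist (wordOf win (c * n) x) (wordOf win (c * n) y)
        ≤ 1 := by
      by_cases he : wordOf win (c * n) x = wordOf win (c * n) y
      · simp [he]
      · exact (SimpleGraph.edist_eq_one_iff_adj.2 ((wordGraph_adj_iff h).2 ⟨he, hxy⟩)).le
    rw [pathDist, max_eq_left h1]
    simp
  · intro hn x y
    by_cases htop : (wordGraph win Y Z (c * n)).edist (wordOf win (c * n) x)
        (wordOf win (c * n) y) = ⊤
    · rw [pathDist, htop]
      simp [ENNReal.top_mul (weight_pos n).ne']
    · obtain ⟨p, hp⟩ := SimpleGraph.exists_walk_of_edist_ne_top htop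
      rw [pathDist, ← hp]
      refine (le_length_mul_weight h hd hn p x y rfl rfl).trans_eq ?_
      congr 1
      rw [ENat.toENNReal_max]
      simp
end WordGraph

/-! ### Chain metrics of contracting sequences of relations -/

section Chains

variable {X : Type*}

/-- There is a chain from `x` to `y` whose steps belong to the relations `U n`, for the numbers `n`
in the list. -/
def Chain (U : ℕ → X → X → Prop) : List ℕ → X → X → Prop
  | [], x, y => x = y
  | n :: l, x, y => ∃ z, U n x z ∧ Chain U l z y

/-- The cost of a chain, where a step in `U n` has the cost `2^{1-n}`. -/
noncomputable def cost (l : List ℕ) : ℝ := (l.map fun n => 2 * (1 / 2 : ℝ) ^ n).sum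

@[simp] theorem cost_nil : cost [] = 0 := rfl

@[simp] theorem cost_cons (n : ℕ) (l : List ℕ) : cost (n :: l) = 2 * (1 / 2) ^ n + cost l := by
  simp [cost]

@[simp] theorem cost_append (l l' : List ℕ) : cost (l ++ l') = cost l + cost l' := by
  simp [cost]

@[simp] theorem cost_reverse (l : List ℕ) : cost l.reverse = cost l := by
  simp [cost, List.sum_reverse]

theorem cost_nonneg (l : List ℕ) : 0 ≤ cost l := by
  induction l with
  | nil => simp
  | cons n l ih => rw [cost_cons]; positivity

theorem weight_eq_ofReal (n : ℕ) : weight n = ENNReal.ofReal (2 * (1 / 2) ^ n) := by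
  rw [weight, ENNReal.ofReal_mul (by simp), ENNReal.ofReal_pow (by simp)]
  congr
  · simp
  · rw [one_div, ENNReal.ofReal_inv_of_pos (by simp)]; simp

/-- The least cost of a chain from `x` to `y`. -/
noncomputable def chainDist (U : ℕ → X → X → Prop) (x y : X) : ℝ≥0∞ :=
  ⨅ (l : List ℕ) (_ : Chain U l x y), ENNReal.ofReal (cost l)

theorem chain_append {U : ℕ → X → X → Prop} {l l' : List ℕ} {x y : X} :
    Chain U (l ++ l') x y ↔ ∃ z, Chain U l x z ∧ Chain U l' z y := by
  induction l generalizing x with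
  | nil => simp [Chain]
  | cons n l ih =>
    simp only [List.cons_append, Chain, ih]
    constructor
    · rintro ⟨z, hz, w, hw, h⟩; exact ⟨w, ⟨z, hz, hw⟩, h⟩
    · rintro ⟨w, ⟨z, hz, hw⟩, h⟩; exact ⟨z, hz, w, hw, h⟩

theorem chain_singleton {U : ℕ → X → X → Prop} {n : ℕ} {x y : X} : Chain U [n] x y ↔ U n x y := by
  simp [Chain]

theorem Chain.reverse {U : ℕ → X → X → Prop} (hU : ∀ n x y, U n x y → U n y x) {l : List ℕ}
    {x y : X} (h : Chain U l x y) : Chain U l.reverse y x := by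
  induction l generalizing x with
  | nil => exact h.symm
  | cons n l ih =>
    obtain ⟨z, hz, hl⟩ := h
    rw [List.reverse_cons, chain_append]
    exact ⟨z, ih hl, chain_singleton.2 (hU _ _ _ hz)⟩

theorem chainDist_le {U : ℕ → X → X → Prop} {l : List ℕ} {x y : X} (h : Chain U l x y) :
    chainDist U x y ≤ ENNReal.ofReal (cost l) :=
  iInf₂_le l h

theorem isPseudometric_chainDist {U : ℕ → X → X → Prop} (hU : ∀ n x y, U n x y → U n y x) :
    IsPseudometric (chainDist U) where
  self x := by
    have : Chain U [] x x := rfl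
    simpa using chainDist_le this
  symm := by
    have : ∀ x y, chainDist U x y ≤ chainDist U y x := fun x y => le_iInf₂ fun l hl => by
      simpa using chainDist_le (hl.reverse hU)
    exact fun x y => (this x y).antisymm (this y x)
  triangle x y z := by
    rw [chainDist, chainDist, chainDist, ENNReal.iInf_add]
    refine le_iInf fun l => ?_
    rw [ENNReal.iInf_add]
    refine le_iInf fun hl => ?_
    rw [ENNReal.add_iInf]
    refine le_iInf fun l' => ?_
    rw [ENNReal.add_iInf]
    refine le_iInf fun hl' => ?_
    rw [← ENNReal.ofReal_add (cost_nonneg _) (cost_nonneg _), ← cost_append]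
    exact chainDist_le (chain_append.2 ⟨y, hl, hl'⟩)

theorem chainDist_le_weight {U : ℕ → X → X → Prop} {n : ℕ} {x y : X} (h : U n x y) :
    chainDist U x y ≤ weight n := by
  rw [weight_eq_ofReal]
  simpa using chainDist_le (chain_singleton.2 h)

theorem le_chainDist {U : ℕ → X → X → Prop} {d : X → X → ℝ≥0∞} (hd : IsPseudometric d)
    (h : ∀ n x y, U n x y → d x y ≤ weight n) (x y : X) : d x y ≤ chainDist U x y := by
  refine le_iInf₂ fun l hl => ?_
  induction l generalizing x with
  | nil => obtain rfl : x = y := hl; simp [hd.self]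
  | cons n l ih =>
    obtain ⟨z, hz, hl⟩ := hl
    rw [cost_cons, ENNReal.ofReal_add (by positivity) (cost_nonneg _), ← weight_eq_ofReal]
    exact (hd.triangle x z y).trans (add_le_add (h _ _ _ hz) (ih z hl))

/-- A decreasing sequence of reflexive and symmetric relations such that five steps in `U (n + 1)`
are a step in `U n`. -/
structure IsContracting (U : ℕ → X → X → Prop) : Prop where
  refl : ∀ n x, U n x x
  symm : ∀ n x y, U n x y → U n y x
  mono : ∀ m n x y, m ≤ n → U n x y → U m x y
  contract : ∀ n (x : ℕ → X), (∀ i < 5, U (n + 1) (x i) (x (i + 1))) → U n (x 0) (x 5)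

theorem Chain.exists_seq {U : ℕ → X → X → Prop} (hU : IsContracting U) {n : ℕ} (K : ℕ) {l : List ℕ}
    {x y : X} (hl : ∀ k ∈ l, n ≤ k) (hK : l.length ≤ K) (h : Chain U l x y) :
    ∃ f : ℕ → X, f 0 = x ∧ f K = y ∧ ∀ i < K, U n (f i) (f (i + 1)) := by
  induction K generalizing l x with
  | zero =>
    obtain rfl : l = [] := by simpa using hK
    exact ⟨fun _ => x, rfl, h, by simp⟩
  | succ K ih =>
    cases l with
    | nil => obtain rfl : x = y := h; exact ⟨fun _ => x, rfl, rfl, fun _ _ => hU.refl _ _⟩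
    | cons m l =>
      obtain ⟨z, hz, hzy⟩ := h
      obtain ⟨f, hf0, hfK, hf⟩ := ih (fun k hk => hl k (by simp [hk])) (by simpa using hK) hzy
      refine ⟨fun i => Nat.casesOn i x f, rfl, hfK, fun i hi => ?_⟩
      cases i with
      | zero =>
        show U n x (f 0)
        rw [hf0]
        exact hU.mono _ _ _ _ (hl m (by simp)) hz
      | succ i => exact hf i (by omega)

/-- Reflexivity pads the chain to five steps, and monotonicity brings all of them to level `n + 1`.
-/
theorem IsContracting.of_chain {U : ℕ → X → X → Prop} (hU : IsContracting U) {n : ℕ} {l : List ℕ}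
    {x y : X} (hl : ∀ k ∈ l, n + 1 ≤ k) (hlen : l.length ≤ 5) (h : Chain U l x y) : U n x y := by
  obtain ⟨f, rfl, rfl, hf⟩ := h.exists_seq hU 5 hl hlen
  exact hU.contract n f hf

theorem exists_split (l : List ℕ) (T : ℝ) (h0 : 0 < T) (hT : T ≤ cost l) :
    ∃ l₁ m l₂, l = l₁ ++ m :: l₂ ∧ cost l₁ < T ∧ T ≤ cost l₁ + 2 * (1 / 2) ^ m := by
  induction l generalizing T with
  | nil => simp at hT; linarith
  | cons n l ih =>
    rw [cost_cons] at hT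
    by_cases hn : T ≤ 2 * (1 / 2) ^ n
    · exact ⟨[], n, l, rfl, by simpa, by simpa using hn⟩
    · obtain ⟨l₁, m, l₂, rfl, h1, h2⟩ := ih (T - 2 * (1 / 2) ^ n) (by linarith) (by linarith)
      exact ⟨n :: l₁, m, l₂, rfl, by rw [cost_cons]; linarith, by rw [cost_cons]; linarith⟩

theorem lt_of_weight_lt {m n : ℕ} (h : 2 * (1 / 2 : ℝ) ^ m < 2 * (1 / 2) ^ n) : n < m := by
  by_contra! hle
  have : (1 / 2 : ℝ) ^ n ≤ (1 / 2) ^ m := pow_le_pow_of_le_one (by norm_num) (by norm_num) hle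
  linarith

/-- Chains of low cost are shortcut by the relation `U n`. -/
theorem IsContracting.of_cost_lt {U : ℕ → X → X → Prop} (hU : IsContracting U) {n : ℕ}
    {l : List ℕ} {x y : X} (h : Chain U l x y) (hl : cost l < 2 * (1 / 2) ^ n) : U n x y := by
  induction hk : l.length using Nat.strong_induction_on generalizing l x y n with
  | _ k ih =>
    subst hk
    rcases List.eq_nil_or_concat' l with rfl | ⟨l', p, rfl⟩
    · obtain rfl : x = y := h
      exact hU.refl _ _
    have hpos : 0 < cost (l' ++ [p]) := by
      have := cost_nonneg l'
      rw [cost_append, cost_cons, cost_nil]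
      positivity
    generalize l' ++ [p] = l at *
    -- The chain is cut at the step that reaches half of the cost. The two remaining parts cost at
    -- most half each, so by induction each is one step of level `n + 1`; the middle step costs less
    -- than `2^{1-n}`, so its level is at least `n + 1` as well.
    obtain ⟨l₁, m, l₂, rfl, h1, h2⟩ := exists_split l (cost l / 2) (by linarith) (by linarith)
    rw [cost_append, cost_cons] at *
    obtain ⟨z, hxz, w, hzw, hwy⟩ := chain_append.1 h
    have hpow : 2 * (1 / 2 : ℝ) ^ (n + 1) = (2 * (1 / 2) ^ n) / 2 := by rw [pow_succ]; ring
    have e1 : U (n + 1) x z := ih _ (by simp) hxz (by linarith) rfl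
    have e3 : U (n + 1) w y := ih _ (by simp; omega) hwy (by linarith) rfl
    have e2 : n < m := lt_of_weight_lt (by
      have := cost_nonneg l₁
      have := cost_nonneg l₂
      linarith)
    refine hU.of_chain (l := [n + 1, m, n + 1]) ?_ (by simp) ⟨z, e1, w, hzw, y, e3, rfl⟩
    simpa using e2

/-- Greedy shortening: the part before the total reaches `1` collapses to one step of level 1, the
step that reaches `1` is kept, and the cost left has dropped by at least `1`. So each unit of cost
contributes two steps. -/
theorem IsContracting.exists_short {U : ℕ → X → X → Prop} (hU : IsContracting U) (j : ℕ)
    {l : List ℕ} {x y : X} (hl : ∀ k ∈ l, 1 ≤ k) (h : Chain U l x y) (hj : cost l < j + 1) :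
    ∃ l' : List ℕ, l'.length ≤ 2 * j + 1 ∧ (∀ k ∈ l', 1 ≤ k) ∧ Chain U l' x y := by
  induction j generalizing l x with
  | zero =>
    exact ⟨[1], by simp, by simp, chain_singleton.2 (hU.of_cost_lt h (by simpa using hj))⟩
  | succ j ih =>
    by_cases h1 : cost l < 1
    · exact ⟨[1], by simp, by simp, chain_singleton.2 (hU.of_cost_lt h (by simpa using h1))⟩
    obtain ⟨l₁, m, l₂, rfl, h2, h3⟩ := exists_split l 1 one_pos (not_lt.1 h1)
    obtain ⟨z, hxz, w, hzw, hwy⟩ := chain_append.1 h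
    rw [cost_append, cost_cons] at hj
    push_cast at hj
    obtain ⟨l', hlen, hl', hc⟩ := ih (fun k hk => hl k (by simp [hk])) hwy (by linarith)
    refine ⟨1 :: m :: l', by simp; omega, ?_, z, hU.of_cost_lt hxz (by simpa using h2), w, hzw, hc⟩
    have := hl m (by simp)
    simpa [this] using hl'

/-- Here `exists_short` with `j = 2` leaves five steps, which is the reason for the number five in
`IsContracting`. -/
theorem IsContracting.of_cost_lt_three {U : ℕ → X → X → Prop} (hU : IsContracting U) {l : List ℕ}
    {x y : X} (hl : ∀ k ∈ l, 1 ≤ k) (h : Chain U l x y) (hj : cost l < 3) : U 0 x y := by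
  obtain ⟨l', hlen, hl', hc⟩ := hU.exists_short 2 hl h (by norm_num; exact hj)
  exact hU.of_chain hl' hlen hc

/-- There is a nonempty chain of cost `k` from `x` to `y` that uses only the relations `U 0` and
`U 1`. -/
def CoarseChain (U : ℕ → X → X → Prop) (k : ℕ) (x y : X) : Prop :=
  ∃ l : List ℕ, l ≠ [] ∧ (∀ i ∈ l, i ≤ 1) ∧ cost l = k ∧ Chain U l x y

theorem CoarseChain.trans {U : ℕ → X → X → Prop} {k k' : ℕ} {x y z : X}
    (h : CoarseChain U k x y) (h' : CoarseChain U k' y z) : CoarseChain U (k + k') x z := by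
  obtain ⟨l, h1, h2, h3, h4⟩ := h
  obtain ⟨l', -, h2', h3', h4'⟩ := h'
  refine ⟨l ++ l', by simp [h1], ?_, by simp [h3, h3'], chain_append.2 ⟨y, h4, h4'⟩⟩
  intro i hi
  rcases List.mem_append.1 hi with hi | hi
  · exact h2 i hi
  · exact h2' i hi

theorem coarseChain_two {U : ℕ → X → X → Prop} {x y : X} (h : U 0 x y) : CoarseChain U 2 x y :=
  ⟨[0], by simp, by simp, by simp, chain_singleton.2 h⟩

theorem coarseChain_one {U : ℕ → X → X → Prop} {x y : X} (h : U 1 x y) : CoarseChain U 1 x y :=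
  ⟨[1], by simp, by simp, by simp, chain_singleton.2 h⟩

theorem forall_or_exists_zero (l : List ℕ) :
    (∀ k ∈ l, 1 ≤ k) ∨ ∃ l₁ l₂, l = l₁ ++ 0 :: l₂ ∧ ∀ k ∈ l₁, 1 ≤ k := by
  induction l with
  | nil => simp
  | cons n l ih =>
    obtain _ | n := n
    · exact Or.inr ⟨[], l, rfl, by simp⟩
    · rcases ih with ih | ⟨l₁, l₂, rfl, h⟩
      · exact Or.inl (by simpa using ih)
      · exact Or.inr ⟨(n + 1) :: l₁, l₂, rfl, by simpa using h⟩

/-- Chains of cost at least `1` can be replaced by coarse ones at `5/2` of the cost. -/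
theorem IsContracting.exists_coarseChain {U : ℕ → X → X → Prop} (hU : IsContracting U)
    {l : List ℕ} {x y : X} (h : Chain U l x y) :
    cost l < 1 ∨ ∃ k : ℕ, CoarseChain U k x y ∧ (2 * k : ℝ) ≤ 5 * cost l := by
  induction hk : l.length using Nat.strong_induction_on generalizing l x with
  | _ n ih =>
    subst hk
    -- A remainder of cost below `1`, possibly empty, is charged as one step of level 1. This
    -- accounts for the extra `2`, to be absorbed by the part cut off before it.
    have hrec : ∀ (l' : List ℕ) (z : X), l'.length < l.length → Chain U l' z y →
        ∃ k : ℕ, CoarseChain U k z y ∧ (2 * k : ℝ) ≤ 5 * cost l' + 2 := by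
      intro l' z hlen hl'
      rcases ih _ hlen hl' rfl with h1 | ⟨k, hk, hk'⟩
      · refine ⟨1, coarseChain_one (hU.of_cost_lt hl' (by simpa using h1)), ?_⟩
        have := cost_nonneg l'
        norm_num
        linarith
      · exact ⟨k, hk, by linarith⟩
    -- Without level 0 every step costs at most `1`, so the shortest initial part of cost at least
    -- `2` costs less than `3` and is one step of level 0. Its doubled cost `4` and the extra `2`
    -- stay below `5 * 2`.
    have hcut : ∀ l₁ l₂ : List ℕ, l = l₁ ++ l₂ → (∀ k ∈ l₁, 1 ≤ k) → 2 ≤ cost l₁ →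
        ∃ k : ℕ, CoarseChain U k x y ∧ (2 * k : ℝ) ≤ 5 * cost l := by
      rintro l₁ l₂ rfl hl₁ h2
      obtain ⟨a, m, b, rfl, h3, h4⟩ := exists_split l₁ 2 two_pos h2
      rw [show a ++ m :: b ++ l₂ = (a ++ [m]) ++ (b ++ l₂) by simp] at h ⊢
      obtain ⟨z, hxz, hzy⟩ := chain_append.1 h
      obtain ⟨k, hk, hk'⟩ := hrec (b ++ l₂) z (by simp; omega) hzy
      have hm : 2 * (1 / 2 : ℝ) ^ m ≤ 1 := by
        have : (1 / 2 : ℝ) ^ m ≤ (1 / 2) ^ 1 :=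
          pow_le_pow_of_le_one (by norm_num) (by norm_num) (hl₁ m (by simp))
        linarith
      have h0 : U 0 x z := by
        refine hU.of_cost_lt_three (l := a ++ [m]) (fun k hk => hl₁ k ?_) hxz ?_
        · simp only [List.mem_append, List.mem_cons, List.not_mem_nil] at hk ⊢
          tauto
        · rw [cost_append, cost_cons, cost_nil]; linarith
      refine ⟨2 + k, (coarseChain_two h0).trans hk, ?_⟩
      rw [cost_append, cost_append a, cost_cons, cost_nil]
      push_cast
      linarith
    -- If the part before the first step of level 0 is cheaper than `2`, it becomes one step of
    -- level 1 or 0 and the step of level 0 is kept. The cost `2` of the latter absorbs the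
    -- rounding.
    rcases forall_or_exists_zero l with hl | ⟨l₁, l₂, rfl, hl₁⟩
    · by_cases h1 : cost l < 1
      · exact Or.inl h1
      right
      by_cases h2 : cost l < 2
      · refine ⟨2, coarseChain_two (hU.of_cost_lt_three hl h (by linarith)), ?_⟩
        norm_num
        linarith
      · exact hcut l [] (by simp) hl (not_lt.1 h2)
    · right
      by_cases h2 : cost l₁ < 2
      · obtain ⟨z, hxz, w, hzw, hwy⟩ := chain_append.1 h
        obtain ⟨k, hk, hk'⟩ := hrec l₂ w (by simp; omega) hwy
        rw [cost_append, cost_cons, pow_zero]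
        have := cost_nonneg l₁
        by_cases h1 : cost l₁ < 1
        · refine ⟨1 + (2 + k), (coarseChain_one (hU.of_cost_lt hxz (by simpa using h1))).trans
            ((coarseChain_two hzw).trans hk), ?_⟩
          push_cast
          linarith
        · refine ⟨2 + (2 + k), (coarseChain_two (hU.of_cost_lt_three hl₁ hxz (by linarith))).trans
            ((coarseChain_two hzw).trans hk), ?_⟩
          push_cast
          linarith
      · exact hcut l₁ _ rfl hl₁ (not_lt.1 h2)

theorem CoarseChain.chainDist_le {U : ℕ → X → X → Prop} {k : ℕ} {x y : X}
    (h : CoarseChain U k x y) : chainDist U x y ≤ k := by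
  obtain ⟨l, -, -, h3, h4⟩ := h
  simpa [h3] using SoficQuotient.chainDist_le h4

theorem IsContracting.of_chainDist_lt {U : ℕ → X → X → Prop} (hU : IsContracting U) {n : ℕ}
    {x y : X} (h : chainDist U x y < weight n) : U n x y := by
  simp only [chainDist, iInf_lt_iff] at h
  obtain ⟨l, hl, hlt⟩ := h
  rw [weight_eq_ofReal, ENNReal.ofReal_lt_ofReal_iff (by positivity)] at hlt
  exact hU.of_cost_lt hl hlt

/-- A chain of cost below `1` would be a step of level 1, so every chain here has a coarse
replacement. -/
theorem IsContracting.le_chainDist_of_coarse {U : ℕ → X → X → Prop} (hU : IsContracting U)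
    {a : ℝ≥0∞} {x y : X} (hxy : ¬ U 1 x y) (ha : ∀ k : ℕ, CoarseChain U k x y → a ≤ 2 * k / 5) :
    a ≤ chainDist U x y := by
  refine le_iInf₂ fun l hl => ?_
  rcases hU.exists_coarseChain hl with h1 | ⟨k, hk, hk'⟩
  · exact absurd (hU.of_cost_lt hl (by simpa using h1)) hxy
  · refine (ha k hk).trans ?_
    have e : (2 * k / 5 : ℝ≥0∞) = ENNReal.ofReal (2 * k / 5) := by
      rw [ENNReal.ofReal_div_of_pos (by norm_num), ENNReal.ofReal_mul (by norm_num)]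
      simp
    rw [e]
    exact ENNReal.ofReal_le_ofReal (by linarith)

theorem tendsto_weight : Tendsto weight atTop (𝓝 0) := by
  have : Tendsto (fun n : ℕ => (2 : ℝ≥0∞) * 2⁻¹ ^ n) atTop (𝓝 (2 * 0)) :=
    ENNReal.Tendsto.const_mul (ENNReal.tendsto_pow_atTop_nhds_zero_of_lt_one (by simp))
      (Or.inr (by simp))
  rw [mul_zero] at this
  exact this

theorem IsContracting.chainDist_eq_zero_iff {U : ℕ → X → X → Prop} (hU : IsContracting U)
    {x y : X} : chainDist U x y = 0 ↔ ∀ n, U n x y := by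
  constructor
  · exact fun h n => hU.of_chainDist_lt (h ▸ weight_pos n)
  · intro h
    exact le_antisymm (ge_of_tendsto' tendsto_weight fun n => chainDist_le_weight (h n)) bot_le

end Chains

/-! ### The greatest pseudometric and the quotient topology -/

section QuotientMetric

variable {M A : Type*} {win : ℕ → List M} {Y : Set (M → A)} {Z : Set (M → A × A)}

/-- The greatest pseudometric in `boundedPseudometrics win Y Z c`. -/
noncomputable def quotientDist (win : ℕ → List M) (Y : Set (M → A)) (Z : Set (M → A × A))
    (c : ℕ) : Y → Y → ℝ≥0∞ :=
  chainDist fun n => Near win Y Z (c * n)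

theorem isGreatest_quotientDist (h : Equivalence (rel Y Z)) (c : ℕ) :
    IsGreatest (boundedPseudometrics win Y Z c) (quotientDist win Y Z c) := by
  constructor
  · exact (mem_boundedPseudometrics_iff h).2
      ⟨isPseudometric_chainDist fun n x y => Near.symm h, fun n x y hxy =>
        chainDist_le_weight (U := fun n => Near win Y Z (c * n)) hxy⟩
  · intro d hd x y
    obtain ⟨hd, hn⟩ := (mem_boundedPseudometrics_iff h).1 hd
    exact le_chainDist hd hn x y

theorem eventually_forall_mem_eq [TopologicalSpace A] [DiscreteTopology A] (l : List M) (x : Y) :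
    ∀ᶠ y : Y in 𝓝 x, ∀ t ∈ l, (y : M → A) t = (x : M → A) t := by
  refine (eventually_all_finite l.finite_toSet).2 fun t _ => ?_
  have : Continuous fun y : Y => (y : M → A) t :=
    (continuous_apply (A := fun _ : M => A) t).comp continuous_subtype_val
  exact this.continuousAt.eventually ((isOpen_discrete {(x : M → A) t}).mem_nhds rfl)

variable [AddCommMonoidWithOne M]

theorem reachable_of_chain (hw : IsWindows win) (h : Equivalence (rel Y Z)) {c : ℕ} {l : List ℕ}
    {x y : Y} (hl : Chain (fun n => Near win Y Z (c * n)) l x y) :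
    (wordGraph win Y Z 0).Reachable (wordOf win 0 x) (wordOf win 0 y) := by
  induction l generalizing x with
  | nil => obtain rfl : x = y := hl; exact SimpleGraph.Reachable.refl _
  | cons n l ih =>
    obtain ⟨z, hz, hzy⟩ := hl
    refine SimpleGraph.Reachable.trans ?_ (ih hzy)
    by_cases he : wordOf win 0 x = wordOf win 0 z
    · rw [he]
    · exact ((wordGraph_adj_iff h).2 ⟨he, hz.mono hw (Nat.zero_le _)⟩).reachable

theorem quotientDist_eq_top_iff (hw : IsWindows win) (h : Equivalence (rel Y Z)) {c : ℕ} {x y : Y} :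
    quotientDist win Y Z c x y = ⊤ ↔
      ¬ (wordGraph win Y Z 0).Reachable (wordOf win 0 x) (wordOf win 0 y) := by
  constructor
  · rintro htop ⟨p⟩
    have hle := le_length_mul_weight h
      (isPseudometric_chainDist (U := fun n => Near win Y Z (c * n)) fun n x y => Near.symm h)
      (fun x y hxy => chainDist_le_weight (n := 0) hxy) p x y rfl rfl
    rw [show chainDist _ x y = ⊤ from htop, top_le_iff] at hle
    exact ENNReal.mul_ne_top (by simp) (weight_ne_top 0) hle
  · intro hr
    refine iInf₂_eq_top.2 fun l hl => absurd (reachable_of_chain hw h hl) hr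

variable [TopologicalSpace A] [DiscreteTopology A]

theorem exists_isContracting (hw : IsWindows win) (h : IsSoficPerSofic Y Z) :
    ∃ c : ℕ, 1 ≤ c ∧ IsContracting fun n => Near win Y Z (c * n) := by
  obtain ⟨c, hc, hchain⟩ := exists_near_of_chain hw h 5
  exact ⟨c, hc, fun n x => Near.refl h.equivalence x, fun n x y => Near.symm h.equivalence,
    fun m n x y hmn => Near.mono hw (Nat.mul_le_mul_left c hmn), hchain⟩

theorem quotientDist_eq_zero_iff (hw : IsWindows win) (h : IsSoficPerSofic Y Z) {c : ℕ}
    (hc : 1 ≤ c) (hU : IsContracting fun n => Near win Y Z (c * n)) {x y : Y} :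
    quotientDist win Y Z c x y = 0 ↔ rel Y Z x y := by
  rw [quotientDist, hU.chainDist_eq_zero_iff]
  exact ⟨fun hn => rel_of_forall_near hw h hc hn, fun hr n => Near.of_rel hr⟩

theorem IsPseudometric.congr {X : Type*} {d : X → X → ℝ≥0∞} (hd : IsPseudometric d) {x x' y y' : X}
    (hx : d x x' = 0) (hy : d y y' = 0) : d x y = d x' y' := by
  have key : ∀ x x' y y', d x x' = 0 → d y y' = 0 → d x y ≤ d x' y' := fun x x' y y' hx hy =>
    calc d x y ≤ d x x' + (d x' y' + d y' y) :=
          (hd.triangle x x' y).trans (add_le_add le_rfl (hd.triangle x' y' y))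
      _ = d x' y' := by rw [hx, hd.symm y' y, hy]; simp
  exact (key x x' y y' hx hy).antisymm (key x' x y' y (hd.symm x x' ▸ hx) (hd.symm y y' ▸ hy))

theorem continuous_of_forall_edist_lt {X W : Type*} [TopologicalSpace X] [PseudoEMetricSpace W]
    {f : X → W} (h : ∀ x, ∀ ε > 0, ∀ᶠ y in 𝓝 x, edist (f y) (f x) < ε) : Continuous f :=
  continuous_iff_continuousAt.2 fun x => EMetric.tendsto_nhds.2 (h x)

theorem t2Space_of_emetricSpace {X : Type*} [EMetricSpace X] : T2Space X := inferInstance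

/-- A continuous bijection from a compact to a Hausdorff space is closed; here it is the identity.
-/
theorem topology_eq_of_le {X : Type*} {t t' : TopologicalSpace X} (hle : t ≤ t')
    (hc : @CompactSpace X t) (h2 : @T2Space X t') : t' = t := by
  refine le_antisymm (fun s hs => ?_) hle
  have := @Continuous.isClosedMap X X t t' hc h2 id (continuous_id_iff_le.2 hle) sᶜ
    (@isClosed_compl_iff X t s |>.2 hs)
  rw [image_id] at this
  exact (@isClosed_compl_iff X t' s).1 this

theorem metrizes_quotientDist (hw : IsWindows win) (h : IsSoficPerSofic Y Z) {c : ℕ}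
    (hc : 1 ≤ c) (hU : IsContracting fun n => Near win Y Z (c * n)) :
    Metrizes h.equivalence (quotientDist win Y Z c) := by
  have hd : IsPseudometric (quotientDist win Y Z c) :=
    isPseudometric_chainDist fun n x y => Near.symm h.equivalence
  have h0 : ∀ {x y}, quotientDist win Y Z c x y = 0 ↔ rel Y Z x y :=
    quotientDist_eq_zero_iff hw h hc hU
  let S : Setoid Y := Setoid.mk (rel Y Z) h.equivalence
  let E : EMetricSpace (Quotient S) :=
    { edist := Quotient.lift₂ (quotientDist win Y Z c)
        fun x y x' y' hx hy => hd.congr (h0.2 hx) (h0.2 hy)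
      edist_self := by rintro ⟨x⟩; exact hd.self x
      edist_comm := by rintro ⟨x⟩ ⟨y⟩; exact hd.symm x y
      edist_triangle := by rintro ⟨x⟩ ⟨y⟩ ⟨z⟩; exact hd.triangle x y z
      eq_of_edist_eq_zero := by rintro ⟨x⟩ ⟨y⟩ hxy; exact Quotient.sound (h0.1 hxy) }
  refine ⟨E, fun x y => rfl, ?_⟩
  have : CompactSpace Y := isCompact_iff_compactSpace.1 h.sofic_left.isCompact
  have hcont : @Continuous Y (Quotient S) _ E.toUniformSpace.toTopologicalSpace
      (Quotient.mk S) := by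
    refine @continuous_of_forall_edist_lt Y (Quotient S) _ E.toPseudoEMetricSpace _
      fun x ε hε => ?_
    obtain ⟨n, hn⟩ := (tendsto_weight.eventually_lt_const hε).exists
    filter_upwards [eventually_forall_mem_eq (win (c * n)) x] with y hy
    refine lt_of_le_of_lt (chainDist_le_weight (U := fun n => Near win Y Z (c * n)) (n := n) ?_) hn
    exact (near_congr (wordOf_eq_iff.2 hy) rfl).2 (Near.refl h.equivalence x)
  exact topology_eq_of_le (continuous_iff_coinduced_le.1 hcont) inferInstance
    (@t2Space_of_emetricSpace _ E)

end QuotientMetric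

/-! ### Finite automata are primitive recursive -/

section Automata

theorem primrec_foldl_of_finite {σ B O : Type*} [Finite σ] [Finite B] [Primcodable B]
    [Primcodable O] (step : σ → B → σ) (s : σ) (out : σ → O) :
    Primrec fun l : List B => out (l.foldl step s) := by
  obtain ⟨k, ⟨e⟩⟩ := Finite.exists_equiv_fin σ
  have h : Primrec fun l : List B => l.foldl (fun i b => e (step (e.symm i) b)) (e s) :=
    Primrec.list_foldl Primrec.id (Primrec.const _)
      (((Primrec.dom_finite fun p : Fin k × B => e (step (e.symm p.1) p.2)).comp Primrec.snd).to₂)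
  refine ((Primrec.dom_finite fun i : Fin k => out (e.symm i)).comp h).of_eq fun l => ?_
  congr 1
  clear h
  induction l generalizing s with
  | nil => simp
  | cons b l ih => simpa using ih (step s b)

/-- Every function on words of bounded length is primitive recursive. -/
theorem exists_primrec_eq_of_length_le {B O : Type*} [Finite B] [Primcodable B] [Primcodable O]
    (g : List B → O) (L : ℕ) :
    ∃ g' : List B → O, Primrec g' ∧ ∀ l, l.length ≤ L → g' l = g l := by
  have : Finite {l : List B // l.length ≤ L} := (List.finite_length_le B L).to_subtype
  -- The automaton stores the whole word read so far and stops growing at length `L`, so `g` becomes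
  -- a finite output table.
  let step : {l : List B // l.length ≤ L} → B → {l : List B // l.length ≤ L} := fun l b =>
    if h : l.1.length < L then ⟨l.1 ++ [b], by simpa using h⟩ else l
  refine ⟨_, primrec_foldl_of_finite step ⟨[], by simp⟩ fun l => g l.1, fun l hl => ?_⟩
  congr 1
  induction l using List.reverseRecOn with
  | nil => rfl
  | append_singleton l b ih =>
    rw [List.foldl_append]
    simp only [List.length_append, List.length_cons, List.length_nil] at hl
    have ih' := ih (by omega)
    simp only [List.foldl_cons, List.foldl_nil]
    generalize List.foldl step _ l = q at *
    subst ih'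
    simp only [step]
    rw [dif_pos (by omega)]

/-- The words that label finite paths from `I` to `F` in a finite graph form a primitive recursive
set. -/
theorem exists_primrec_path {Q B : Type*} [Finite Q] [Finite B] [Primcodable B]
    (T : Q → Q → Prop) (lab : Q → B) (I F : Set Q) :
    ∃ acc : List B → Bool, Primrec acc ∧ ∀ u, acc u = true ↔ ∃ l : List Q, l.map lab = u ∧
      l.IsChain T ∧ (∃ q ∈ l.head?, q ∈ I) ∧ ∃ q ∈ l.getLast?, q ∈ F := by
  classical
  -- Subset construction: the state is the set of possible last vertices, and `none` means that no
  -- letter has been read.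
  let step : Option (Set Q) → B → Option (Set Q) := fun s b =>
    match s with
    | none => some {q | q ∈ I ∧ lab q = b}
    | some S => some {q | (∃ p ∈ S, T p q) ∧ lab q = b}
  let reach : List B → Set Q := fun u => {q | ∃ l : List Q, (l ++ [q]).map lab = u ∧
    (l ++ [q]).IsChain T ∧ ∃ p ∈ (l ++ [q]).head?, p ∈ I}
  have hfold : ∀ u b, (u ++ [b]).foldl step none = some (reach (u ++ [b])) := by
    intro u
    induction u using List.reverseRecOn with
    | nil =>
      intro b
      simp only [List.nil_append, List.foldl_cons, List.foldl_nil, step, Option.some.injEq]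
      ext q
      constructor
      · rintro ⟨hq, rfl⟩
        exact ⟨[], by simp, by simp, q, by simp, hq⟩
      · rintro ⟨l, hl, -, p, hp, hpI⟩
        obtain rfl : l = [] := by
          have := congrArg List.length hl
          simpa using this
        simp only [List.nil_append, List.head?_cons, Option.mem_some_iff] at hp
        subst hp
        exact ⟨hpI, by simpa using hl⟩
    | append_singleton u b ih =>
      intro b'
      rw [List.foldl_append, ih b]
      simp only [List.foldl_cons, List.foldl_nil, step, Option.some.injEq]
      ext q
      constructor
      · rintro ⟨⟨p, ⟨l, hl, hc, p₀, hp₀, hI⟩, hT⟩, rfl⟩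
        refine ⟨l ++ [p], by rw [List.map_append, hl]; rfl, ?_, p₀, ?_, hI⟩
        · rw [List.isChain_append]
          refine ⟨hc, by simp, fun x hx y hy => ?_⟩
          simp only [List.getLast?_append, List.getLast?_singleton, Option.some_or,
            Option.mem_some_iff, List.head?_cons] at hx hy
          subst hx hy
          exact hT
        · rw [List.head?_append]
          simp only [Option.mem_def] at hp₀
          simp [hp₀]
      · rintro ⟨l, hl, hc, p₀, hp₀, hI⟩
        rw [List.map_append] at hl
        obtain ⟨hl1, hl2⟩ := List.append_inj' hl (by simp)
        rcases List.eq_nil_or_concat' l with rfl | ⟨l, p, rfl⟩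
        · simp at hl1
        rw [List.isChain_append] at hc
        refine ⟨⟨p, ⟨l, hl1, hc.1, p₀, ?_, hI⟩, hc.2.2 p (by simp) q (by simp)⟩, by simpa using hl2⟩
        rw [List.head?_append] at hp₀
        cases l <;> simpa using hp₀
  refine ⟨_, primrec_foldl_of_finite step none fun s =>
    match s with
    | none => false
    | some S => decide (∃ q ∈ S, q ∈ F), fun u => ?_⟩
  rcases List.eq_nil_or_concat' u with rfl | ⟨u, b, rfl⟩
  · simp only [List.foldl_nil, Bool.false_eq_true, List.map_eq_nil_iff, false_iff]
    rintro ⟨l, rfl, -, ⟨q, hq, -⟩, -⟩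
    simp at hq
  · rw [hfold]
    simp only [decide_eq_true_eq]
    constructor
    · rintro ⟨q, ⟨l, hl, hc, hI⟩, hF⟩
      exact ⟨l ++ [q], hl, hc, hI, q, by simp, hF⟩
    · rintro ⟨l, hl, hc, hI, q, hq, hF⟩
      rcases List.eq_nil_or_concat' l with rfl | ⟨l, p, rfl⟩
      · simp at hq
      simp only [List.getLast?_append, List.getLast?_singleton, Option.some_or,
        Option.mem_some_iff] at hq
      subst hq
      exact ⟨p, ⟨l, hl, hc, hI⟩, hF⟩

theorem primrec_zip {B : Type*} [Primcodable B] :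
    Primrec fun p : List B × List B => p.1.zip p.2 := by
  have hz : ∀ u v : List B, (List.range u.length).filterMap
      (fun i => (u[i]?).bind fun a => (v[i]?).map fun b => (a, b)) = u.zip v := by
    intro u
    induction u with
    | nil => simp
    | cons a u ih =>
      intro v
      rw [List.length_cons, List.range_succ_eq_map, List.filterMap_cons, List.filterMap_map]
      cases v with
      | nil => simp
      | cons b v => simp [ih]
  refine (Primrec.listFilterMap (Primrec.list_range.comp (Primrec.list_length.comp Primrec.fst)) ?_).of_eq
    fun p => hz p.1 p.2
  refine Primrec.option_bind (Primrec.list_getElem?.comp (Primrec.fst.comp Primrec.fst) Primrec.snd)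
    (Primrec.option_map (Primrec.list_getElem?.comp (Primrec.snd.comp (Primrec.fst.comp Primrec.fst))
      (Primrec.snd.comp Primrec.fst)) ?_)
  exact Primrec.pair (Primrec.snd.comp Primrec.fst) Primrec.snd

end Automata

/-! ### Deciding nearness, and computing from oracles -/

section Deciders

variable {M A : Type*} [AddCommMonoidWithOne M] {win : ℕ → List M} [TopologicalSpace A]
  [DiscreteTopology A] [Finite A] [Primcodable A] {Y : Set (M → A)} {Z : Set (M → A × A)}

/-- It is decidable whether two words are the words of related points. -/
theorem exists_primrec_related (hw : IsWindows win) (h : IsSoficPerSofic Y Z) :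
    ∃ nd : List A × List A → Bool, Primrec nd ∧ ∀ (m : ℕ) (u v : List A),
      u.length = (win m).length → v.length = (win m).length →
      (nd (u, v) = true ↔ ∃ x y : Y, word win m x = u ∧ word win m y = v ∧ rel Y Z x y) := by
  obtain ⟨Q, _, T, lab, hP⟩ := h.exists_isPresentation hw.intervals
  obtain ⟨I, F, hIF⟩ := hw.extend T
  obtain ⟨acc, hacc, hacc'⟩ := exists_primrec_path T lab I F
  -- The window enters only through the length of the words, so one automaton serves for all `m`.
  refine ⟨fun p => acc (p.1.zip p.2), hacc.comp primrec_zip, fun m u v hu hv => ?_⟩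
  rw [hacc']
  have hlen : (u.zip v).length = (win m).length := by simp [hu, hv]
  constructor
  · rintro ⟨l, hl, hl'⟩
    obtain ⟨r, hr, rfl⟩ := (hIF m l).2 ⟨by rw [← hlen, ← hl, List.length_map], hl'⟩
    have hz := (hP fun t => lab (r t)).2 ⟨r, hr, fun _ => rfl⟩
    rw [List.map_map] at hl
    refine ⟨⟨_, hz.1⟩, ⟨_, hz.2.1⟩, ?_, ?_, hz.2.2⟩
    · have := congrArg (List.map Prod.fst) hl
      rw [List.map_fst_zip (by simp [hu, hv]), List.map_map] at this
      exact this
    · have := congrArg (List.map Prod.snd) hl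
      rw [List.map_snd_zip (by simp [hu, hv]), List.map_map] at this
      exact this
  · rintro ⟨x, y, rfl, rfl, hr⟩
    obtain ⟨r, hr, hlab⟩ := (hP _).1 (⟨x.2, y.2, hr⟩ :
      (fun t => ((x : M → A) t, (y : M → A) t)) ∈ relatedPairs Y Z)
    refine ⟨(win m).map r, ?_, ((hIF m _).1 ⟨r, hr, rfl⟩).2⟩
    rw [List.map_map, word, word, List.zip_map', Function.comp_def]
    simp only [hlab]

omit [AddCommMonoidWithOne M] [TopologicalSpace A] [DiscreteTopology A] [Finite A] in
/-- Functions of the words in a computable window are computable. -/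
theorem computableOnPoints_of_primrec {ι O : Type*} [Primcodable ι] [Primcodable O]
    (hmono : StrictMono fun m => (win m).length) (hlen : Primrec fun m => (win m).length)
    {lev : ι → ℕ} (hlev : Primrec lev) {g : (List A × List A) × ι → O} (hg : Primrec g) :
    ComputableOnPoints win fun (x y : Y) i =>
      g ((word win (lev i) (x : M → A), word win (lev i) (y : M → A)), i) := by
  -- The algorithm does not receive the number of the window but recognizes it by the word length.
  -- Lengths increase strictly, so the first answer comes exactly at `lev i`.
  refine ⟨fun p => if p.1.1.length < (win (lev p.2)).length then none else some (g p),
    (Primrec.ite (Primrec.nat_lt.comp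
      (Primrec.list_length.comp (Primrec.fst.comp Primrec.fst))
      (hlen.comp (hlev.comp Primrec.snd))) (Primrec.const none)
      (Primrec.option_some.comp hg)).to_comp, fun x y i => ⟨lev i, ?_, fun N hN => ?_⟩⟩
  · simp [word]
  · exact if_pos (by simpa [word] using hmono hN)

end Deciders

/-! ### Approximating the distance up to a factor 5/2 -/

section Approximation

variable {M A : Type*} [AddCommMonoidWithOne M] {win : ℕ → List M} {Y : Set (M → A)}
  {Z : Set (M → A × A)}

/-- Only the end points change, and each step sees only their words. The empty chain is excluded
because it demands equality of the points, which words cannot detect. -/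
theorem chain_congr (hw : IsWindows win) {c L : ℕ} {l : List ℕ} (hl : l ≠ [])
    (hL : ∀ i ∈ l, i ≤ L) {x x' y y' : Y} (hx : wordOf win (c * L) x = wordOf win (c * L) x')
    (hy : wordOf win (c * L) y = wordOf win (c * L) y')
    (h : Chain (fun n => Near win Y Z (c * n)) l x y) :
    Chain (fun n => Near win Y Z (c * n)) l x' y' := by
  induction l generalizing x x' with
  | nil => exact absurd rfl hl
  | cons n l ih =>
    obtain ⟨z, hz, hzy⟩ := h
    have hn : c * n ≤ c * L := Nat.mul_le_mul_left c (hL n (by simp))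
    by_cases hl' : l = []
    · subst hl'
      obtain rfl : z = y := hzy
      exact ⟨y', (near_congr (wordOf_eq_of_le hw hn hx) (wordOf_eq_of_le hw hn hy)).1 hz, rfl⟩
    · exact ⟨z, (near_congr (wordOf_eq_of_le hw hn hx) rfl).1 hz,
        ih hl' (fun i hi => hL i (by simp [hi])) rfl hzy⟩

omit [AddCommMonoidWithOne M] in
theorem wordOf_eq_of_word_eq {m : ℕ} {x y : Y}
    (h : word win m (x : M → A) = word win m (y : M → A)) : wordOf win m x = wordOf win m y :=
  Subtype.ext h

theorem primrec_two_pow : Primrec fun n : ℕ => 2 ^ n := by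
  refine (Primrec.nat_rec₁ 1 (f := fun _ p => 2 * p)
    (Primrec.nat_mul.comp (Primrec.const 2) Primrec.snd).to₂).of_eq fun n => ?_
  induction n with
  | zero => rfl
  | succ n ih => rw [pow_succ', ← ih]

/-- Words can be restricted to smaller windows by an algorithm. -/
theorem exists_primrec_restrict [Primcodable A] (hw : IsWindows win) :
    ∃ tr : (ℕ × ℕ) × List A → List A, Primrec tr ∧
      ∀ m N, m ≤ N → ∀ x : M → A, tr ((m, N), word win N x) = word win m x := by
  obtain ⟨off, hoff, ho⟩ := hw.trunc
  refine ⟨fun p => (p.2.drop (off p.1.1 p.1.2)).take (win p.1.1).length, ?_, fun m N h x => ?_⟩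
  · exact Primrec.list_take.comp (hw.length_primrec.comp (Primrec.fst.comp Primrec.fst))
      (Primrec.list_drop.comp (hoff.comp (Primrec.fst.comp Primrec.fst)
        (Primrec.snd.comp Primrec.fst)) Primrec.snd)
  · beta_reduce
    rw [word, word, ← List.map_drop, ← List.map_take, ← ho m N h]

omit [AddCommMonoidWithOne M] in
theorem near_iff_exists_word {m : ℕ} {x y : Y} : Near win Y Z m x y ↔ ∃ x' y' : Y,
    word win m (x' : M → A) = word win m (x : M → A) ∧
    word win m (y' : M → A) = word win m (y : M → A) ∧ rel Y Z x' y' := by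
  simp only [Near, wordOf]
  exact exists₂_congr fun _ _ => and_congr Subtype.ext_iff (and_congr_left fun _ => Subtype.ext_iff)

theorem extRat_zero : extRat (some (0, 0)) = 0 := by simp [extRat]

theorem extRat_two_pow (n : ℕ) : extRat (some (1, 2 ^ n - 1)) = weight (n + 1) := by
  have h : ((2 ^ n - 1 : ℕ) : ℝ≥0∞) + 1 = 2 ^ n := by
    have : 2 ^ n - 1 + 1 = 2 ^ n := Nat.sub_add_cancel Nat.one_le_two_pow
    exact_mod_cast this
  simp only [extRat, weight, h]
  rw [pow_succ', ← mul_assoc, ENNReal.mul_inv_cancel (by simp) (by simp), one_mul, ← ENNReal.inv_pow]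
  simp

theorem weight_eq_two_mul (n : ℕ) : weight n = 2 * weight (n + 1) := by
  rw [weight, weight, pow_succ', ← mul_assoc (2 : ℝ≥0∞) 2⁻¹, ENNReal.mul_inv_cancel (by simp)
    (by simp), one_mul]

/-- Explains the level `b + 2` in the algorithm: `1 / 2^{b+1}` is at most `1 / (b + 1)`. -/
theorem weight_le_posRat (a b : ℕ) : weight (b + 2) ≤ posRat (a, b) := by
  rw [← extRat_two_pow (b + 1)]
  simp only [extRat, posRat]
  refine ENNReal.div_le_div ?_ ?_
  · simp
  · have : b + 1 ≤ 2 ^ (b + 1) - 1 + 1 := by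
      have := (Nat.lt_two_pow_self (n := b + 1))
      omega
    exact_mod_cast this

open Classical in
/-- The greatest lower bound `2k/5` for `d(x, y)` that is given by the costs `k` of coarse chains,
as a function of the words of `x` and `y`. -/
noncomputable def coarseBound (win : ℕ → List M) (Y : Set (M → A)) (Z : Set (M → A × A)) (c : ℕ)
    (w : List (A × A)) : Option (ℕ × ℕ) :=
  if h : ∃ k : ℕ, ∃ x y : Y, (word win (c * 1) (x : M → A)).zip (word win (c * 1) (y : M → A)) = w ∧
    CoarseChain (fun n => Near win Y Z (c * n)) k x y then some (2 * Nat.find h, 4) else none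

theorem coarseChain_congr (hw : IsWindows win) {c k : ℕ} {x x' y y' : Y}
    (h : (word win (c * 1) (x : M → A)).zip (word win (c * 1) (y : M → A)) =
      (word win (c * 1) (x' : M → A)).zip (word win (c * 1) (y' : M → A)))
    (hk : CoarseChain (fun n => Near win Y Z (c * n)) k x y) :
    CoarseChain (fun n => Near win Y Z (c * n)) k x' y' := by
  obtain ⟨l, h1, h2, h3, h4⟩ := hk
  refine ⟨l, h1, h2, h3, chain_congr hw h1 h2 (wordOf_eq_of_word_eq ?_) (wordOf_eq_of_word_eq ?_) h4⟩
  · have := congrArg (List.map Prod.fst) h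
    rwa [List.map_fst_zip (by simp [word]), List.map_fst_zip (by simp [word])] at this
  · have := congrArg (List.map Prod.snd) h
    rwa [List.map_snd_zip (by simp [word]), List.map_snd_zip (by simp [word])] at this

-- Every coarse chain from `x` to `y` competes in the minimum; if no coarse chain exists, the chain
-- distance is infinite too.
omit [AddCommMonoidWithOne M] in
theorem coarseBound_le {c : ℕ}
    (hU : IsContracting fun n => Near win Y Z (c * n)) {x y : Y} (hxy : ¬ Near win Y Z (c * 1) x y) :
    extRat (coarseBound win Y Z c ((word win (c * 1) (x : M → A)).zip
      (word win (c * 1) (y : M → A)))) ≤ quotientDist win Y Z c x y := by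
  classical
  refine hU.le_chainDist_of_coarse hxy fun k hk => ?_
  have h : ∃ k : ℕ, ∃ x' y' : Y, (word win (c * 1) (x' : M → A)).zip
      (word win (c * 1) (y' : M → A)) = (word win (c * 1) (x : M → A)).zip
      (word win (c * 1) (y : M → A)) ∧ CoarseChain (fun n => Near win Y Z (c * n)) k x' y' :=
    ⟨k, x, y, rfl, hk⟩
  rw [coarseBound, dif_pos h]
  simp only [extRat]
  have hle : Nat.find h ≤ k := Nat.find_min' h ⟨x, y, rfl, hk⟩
  refine ENNReal.div_le_div ?_ ?_
  · exact_mod_cast Nat.mul_le_mul_left 2 hle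
  · norm_num

/-- A minimal coarse chain joins some points with the same words, hence also `x` and `y`, and `5/2`
times `2k/5` is its cost `k`. -/
theorem le_coarseBound (hw : IsWindows win) {c : ℕ} {x y : Y} :
    quotientDist win Y Z c x y ≤ 5 / 2 * extRat (coarseBound win Y Z c
      ((word win (c * 1) (x : M → A)).zip (word win (c * 1) (y : M → A)))) := by
  classical
  by_cases h : ∃ k : ℕ, ∃ x' y' : Y, (word win (c * 1) (x' : M → A)).zip
      (word win (c * 1) (y' : M → A)) = (word win (c * 1) (x : M → A)).zip
      (word win (c * 1) (y : M → A)) ∧ CoarseChain (fun n => Near win Y Z (c * n)) k x' y'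
  · rw [coarseBound, dif_pos h]
    obtain ⟨x', y', hz, hk⟩ := Nat.find_spec h
    refine (coarseChain_congr hw hz hk).chainDist_le.trans_eq ?_
    simp only [extRat]
    generalize Nat.find h = k
    have e : (k : ℝ≥0∞) = ENNReal.ofReal (5 / 2 * ((2 * k : ℕ) / ((4 : ℕ) + 1))) := by
      rw [← ENNReal.ofReal_natCast]
      congr 1
      push_cast
      ring
    rw [e, ENNReal.ofReal_mul (by norm_num), ENNReal.ofReal_div_of_pos (by norm_num),
      ENNReal.ofReal_div_of_pos (by norm_num), ENNReal.ofReal_natCast,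
      ENNReal.ofReal_add (by norm_num) (by norm_num), ENNReal.ofReal_natCast]
    simp
  · rw [coarseBound, dif_neg h]
    simp [extRat, ENNReal.mul_top]

theorem computablyApproximable_quotientDist [Finite A] [Primcodable A] [TopologicalSpace A]
    [DiscreteTopology A] (hw : IsWindows win) (h : IsSoficPerSofic Y Z) {c : ℕ}
    (hU : IsContracting fun n => Near win Y Z (c * n)) :
    ComputablyApproximable win (quotientDist win Y Z c) := by
  obtain ⟨tr, htr, htr'⟩ := exists_primrec_restrict (A := A) hw
  obtain ⟨nd, hnd, hnd'⟩ := exists_primrec_related hw h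
  obtain ⟨tab, htab, htab'⟩ :=
    exists_primrec_eq_of_length_le (coarseBound win Y Z c) (win (c * 1)).length
  let near : ((List A × List A) × ℕ × ℕ) → ℕ → Bool := fun p n =>
    nd (tr ((c * n, c * (p.2.2 + 2)), p.1.1), tr ((c * n, c * (p.2.2 + 2)), p.1.2))
  have hlev : Primrec fun e : ℕ × ℕ => c * (e.2 + 2) :=
    Primrec.nat_mul.comp (Primrec.const c) (Primrec.nat_add.comp Primrec.snd (Primrec.const 2))
  have hpair : Primrec fun q : ((List A × List A) × ℕ × ℕ) × ℕ =>
      (c * q.2, c * (q.1.2.2 + 2)) :=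
    Primrec.pair (Primrec.nat_mul.comp (Primrec.const c) Primrec.snd)
      (hlev.comp (Primrec.snd.comp Primrec.fst))
  have htr1 : Primrec fun q : ((List A × List A) × ℕ × ℕ) × ℕ =>
      tr ((c * q.2, c * (q.1.2.2 + 2)), q.1.1.1) :=
    htr.comp (Primrec.pair hpair (Primrec.fst.comp (Primrec.fst.comp Primrec.fst)))
  have htr2 : Primrec fun q : ((List A × List A) × ℕ × ℕ) × ℕ =>
      tr ((c * q.2, c * (q.1.2.2 + 2)), q.1.1.2) :=
    htr.comp (Primrec.pair hpair (Primrec.snd.comp (Primrec.fst.comp Primrec.fst)))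
  have hnear : Primrec₂ near := hnd.comp (Primrec.pair htr1 htr2)
  have hnearrel : PrimrecRel fun p n => near p n = true :=
    Primrec.eq.comp hnear (Primrec.const true)
  have hN : Primrec fun p : (List A × List A) × ℕ × ℕ => p.2.2 + 2 :=
    Primrec.nat_add.comp (Primrec.snd.comp Primrec.snd) (Primrec.const 2)
  -- Near at level `b + 2`: the distance is at most `ε`. Otherwise, near at level 1: with `n` the
  -- last level of nearness, the distance lies between `weight (n + 1)`, coded by `(1, 2 ^ n - 1)`,
  -- and its double. Not near at level 1: the table of coarse chains decides.
  let g : ((List A × List A) × ℕ × ℕ) → Option (ℕ × ℕ) := fun p =>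
    if near p (p.2.2 + 2) = true then some (0, 0)
    else if near p 1 = true then
      some (1, 2 ^ (Nat.findGreatest (fun n => near p n = true) (p.2.2 + 2)) - 1)
    else tab ((tr ((c * 1, c * (p.2.2 + 2)), p.1.1)).zip (tr ((c * 1, c * (p.2.2 + 2)), p.1.2)))
  have hg : Primrec g := by
    refine Primrec.ite (hnearrel.comp Primrec.id hN) (Primrec.const _)
      (Primrec.ite (hnearrel.comp Primrec.id (Primrec.const 1)) ?_ ?_)
    · exact Primrec.option_some.comp (Primrec.pair (Primrec.const 1) (Primrec.nat_sub.comp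
        (primrec_two_pow.comp (Primrec.nat_findGreatest hN hnearrel)) (Primrec.const 1)))
    · exact htab.comp (primrec_zip.comp (Primrec.pair
        (htr1.comp (Primrec.pair Primrec.id (Primrec.const 1)))
        (htr2.comp (Primrec.pair Primrec.id (Primrec.const 1)))))
  refine ⟨_, computableOnPoints_of_primrec hw.length_strictMono hw.length_primrec hlev hg,
    fun x y e => ?_⟩
  obtain ⟨a, b⟩ := e
  set p : (List A × List A) × ℕ × ℕ :=
    ((word win (c * (b + 2)) (x : M → A), word win (c * (b + 2)) (y : M → A)), a, b) with hp
  have hnear' : ∀ n ≤ b + 2, near p n = true ↔ Near win Y Z (c * n) x y := by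
    intro n hn
    have hle := Nat.mul_le_mul_left c hn
    simp only [near, hp]
    rw [htr' _ _ hle, htr' _ _ hle, hnd' (c * n) _ _ (by simp [word]) (by simp [word]),
      near_iff_exists_word]
  simp only [g]
  by_cases h1 : near p (p.2.2 + 2) = true
  · rw [if_pos h1, extRat_zero]
    refine ⟨bot_le, ?_⟩
    rw [mul_zero, zero_add]
    exact (chainDist_le_weight (U := fun n => Near win Y Z (c * n))
      ((hnear' _ le_rfl).1 h1)).trans (weight_le_posRat a b)
  rw [if_neg h1]
  by_cases h2 : near p 1 = true
  · rw [if_pos h2, extRat_two_pow]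
    set n := Nat.findGreatest (fun n => near p n = true) (p.2.2 + 2) with hn
    have hle : n ≤ b + 2 := Nat.findGreatest_le _
    have hspec : near p n = true :=
      Nat.findGreatest_spec (P := fun n => near p n = true) (show 1 ≤ p.2.2 + 2 by omega) h2
    have hlt : n < b + 2 := by
      refine lt_of_le_of_ne hle fun he => h1 ?_
      rw [he] at hspec
      exact hspec
    have hnot : ¬ near p (n + 1) = true :=
      Nat.findGreatest_is_greatest (P := fun n => near p n = true) (Nat.lt_succ_self n) hlt
    constructor
    · by_contra! hd
      exact hnot ((hnear' _ hlt).2 (hU.of_chainDist_lt hd))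
    · have hd := chainDist_le_weight (U := fun n => Near win Y Z (c * n))
        ((hnear' _ hle).1 hspec)
      rw [weight_eq_two_mul] at hd
      refine (hd.trans ?_).trans le_self_add
      gcongr
      rw [ENNReal.le_div_iff_mul_le (by simp) (by simp)]
      norm_num
  · rw [if_neg h2]
    have hle : c * 1 ≤ c * (b + 2) := Nat.mul_le_mul_left c (by omega)
    simp only [hp]
    rw [htr' _ _ hle, htr' _ _ hle, htab' _ (by simp [word])]
    exact ⟨coarseBound_le hU fun hxy => h2 ((hnear' 1 (by omega)).2 hxy),
      (le_coarseBound hw).trans le_self_add⟩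

end Approximation

/-! ### Codes of rationals, and costs of chains of words -/

section Enumeration

/-- The minimum of two elements of `ℚ_{≥0} ∪ {∞}`, in terms of their codes. -/
def minCode : Option (ℕ × ℕ) → Option (ℕ × ℕ) → Option (ℕ × ℕ)
  | none, q => q
  | some p, none => some p
  | some p, some q => if p.1 * (q.2 + 1) ≤ q.1 * (p.2 + 1) then some p else some q

theorem extRat_le_iff (p q : ℕ × ℕ) :
    extRat (some p) ≤ extRat (some q) ↔ p.1 * (q.2 + 1) ≤ q.1 * (p.2 + 1) := by
  simp only [extRat]
  rw [ENNReal.div_le_iff (by simp) (by finiteness), div_eq_mul_inv (q.1 : ℝ≥0∞),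
    mul_right_comm, ← div_eq_mul_inv, ENNReal.le_div_iff_mul_le (by simp) (by simp)]
  norm_cast

theorem le_extRat_minCode (a : ℝ≥0∞) (p q : Option (ℕ × ℕ)) :
    a ≤ extRat (minCode p q) ↔ a ≤ extRat p ∧ a ≤ extRat q := by
  obtain _ | p := p
  · simp [minCode, extRat]
  obtain _ | q := q
  · simp [minCode, extRat]
  simp only [minCode]
  split_ifs with h
  · have := (extRat_le_iff p q).2 h
    exact ⟨fun ha => ⟨ha, ha.trans this⟩, fun ha => ha.1⟩
  · have := (le_total (extRat (some p)) (extRat (some q))).resolve_left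
      (fun hle => h ((extRat_le_iff p q).1 hle))
    exact ⟨fun ha => ⟨ha.trans this, ha⟩, fun ha => ha.2⟩

theorem primrec_minCode : Primrec₂ minCode := by
  have : Primrec₂ fun p q : Option (ℕ × ℕ) => (p.casesOn q fun p => q.casesOn (some p) fun q =>
      if p.1 * (q.2 + 1) ≤ q.1 * (p.2 + 1) then some p else some q : Option (ℕ × ℕ)) := by
    have h1 : Primrec fun t : ((Option (ℕ × ℕ) × Option (ℕ × ℕ)) × ℕ × ℕ) × ℕ × ℕ => t.1.2 :=
      Primrec.snd.comp Primrec.fst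
    have h2 : Primrec fun t : ((Option (ℕ × ℕ) × Option (ℕ × ℕ)) × ℕ × ℕ) × ℕ × ℕ => t.2 :=
      Primrec.snd
    have h3 : Primrec₂ fun (t : (Option (ℕ × ℕ) × Option (ℕ × ℕ)) × ℕ × ℕ) (q : ℕ × ℕ) =>
        if t.2.1 * (q.2 + 1) ≤ q.1 * (t.2.2 + 1) then some t.2 else some q :=
      Primrec.ite (Primrec.nat_le.comp
        (Primrec.nat_mul.comp (Primrec.fst.comp h1) (Primrec.succ.comp (Primrec.snd.comp h2)))
        (Primrec.nat_mul.comp (Primrec.fst.comp h2) (Primrec.succ.comp (Primrec.snd.comp h1))))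
        (Primrec.option_some.comp h1) (Primrec.option_some.comp h2)
    have h4 : Primrec₂ fun (t : Option (ℕ × ℕ) × Option (ℕ × ℕ)) (p : ℕ × ℕ) =>
        (t.2.casesOn (some p) fun q =>
          if p.1 * (q.2 + 1) ≤ q.1 * (p.2 + 1) then some p else some q : Option (ℕ × ℕ)) :=
      Primrec.option_casesOn (Primrec.snd.comp Primrec.fst)
        (Primrec.option_some.comp Primrec.snd) h3
    exact Primrec.option_casesOn Primrec.fst Primrec.snd h4
  refine this.of_eq fun p q => ?_
  cases p <;> cases q <;> rfl

/-- The minimum of `val 0, …, val m`. -/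
def minUpTo (val : ℕ → Option (ℕ × ℕ)) (m : ℕ) : Option (ℕ × ℕ) :=
  (List.range (m + 1)).foldl (fun a k => minCode a (val k)) none

theorem le_extRat_minUpTo (a : ℝ≥0∞) (val : ℕ → Option (ℕ × ℕ)) (m : ℕ) :
    a ≤ extRat (minUpTo val m) ↔ ∀ k ≤ m, a ≤ extRat (val k) := by
  have key : ∀ (l : List ℕ) (s : Option (ℕ × ℕ)),
      a ≤ extRat (l.foldl (fun a k => minCode a (val k)) s) ↔
        a ≤ extRat s ∧ ∀ k ∈ l, a ≤ extRat (val k) := by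
    intro l
    induction l with
    | nil => simp
    | cons k l ih => intro s; simp [ih, le_extRat_minCode, and_assoc]
  rw [minUpTo, key]
  simp [extRat]

variable {A : Type*}

/-- The step of the verification of a chain of words in the window number `L`: the word is replaced
by the next one if this is allowed by `ok`. -/
def checkStep (ok : (ℕ × List A) × (ℕ × List A) → Bool) (L : ℕ) (s : Option (List A))
    (p : ℕ × List A) : Option (List A) :=
  s.bind fun u => if ok ((L, u), p) = true then some p.2 else none

/-- The cost of the chain of words from `u` to `v` that is given by `steps`, if there is one. -/
def chainValue (ok : (ℕ × List A) × (ℕ × List A) → Bool) [DecidableEq A] (L : ℕ) (u v : List A)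
    (steps : List (ℕ × List A)) : Option (ℕ × ℕ) :=
  -- The empty list is rejected: it would give the value `0` to distinct points that share a word.
  if steps ≠ [] ∧ steps.foldl (checkStep ok L) (some u) = some v then
    some (steps.foldl (fun a p => a + 2 ^ (L + 1 - p.1)) 0, 2 ^ L - 1) else none

theorem primrec_chainValue [Primcodable A] [DecidableEq A]
    {ok : (ℕ × List A) × (ℕ × List A) → Bool} (hok : Primrec ok) :
    Primrec fun t : (ℕ × List A × List A) × List (ℕ × List A) =>
      chainValue ok t.1.1 t.1.2.1 t.1.2.2 t.2 := by
  let α := (ℕ × List A × List A) × List (ℕ × List A)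
  have hL : Primrec fun t : α => t.1.1 := Primrec.fst.comp Primrec.fst
  have hu : Primrec fun t : α => t.1.2.1 := Primrec.fst.comp (Primrec.snd.comp Primrec.fst)
  have hv : Primrec fun t : α => t.1.2.2 := Primrec.snd.comp (Primrec.snd.comp Primrec.fst)
  have hif : Primrec₂ fun (t : α × Option (List A) × (ℕ × List A)) (u : List A) =>
      if ok ((t.1.1.1, u), t.2.2) = true then some t.2.2.2 else none := by
    have h1 : Primrec fun t : (α × Option (List A) × (ℕ × List A)) × List A => t.1.2.2 :=
      Primrec.snd.comp (Primrec.snd.comp Primrec.fst)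
    have h2 : Primrec fun t : (α × Option (List A) × (ℕ × List A)) × List A => t.1.1.1.1 :=
      hL.comp (Primrec.fst.comp Primrec.fst)
    have h3 : Primrec fun t : (α × Option (List A) × (ℕ × List A)) × List A =>
        ok ((t.1.1.1.1, t.2), t.1.2.2) := hok.comp ((h2.pair Primrec.snd).pair h1)
    exact Primrec.ite (Primrec.eq.comp h3 (Primrec.const true))
      (Primrec.option_some.comp (Primrec.snd.comp h1)) (Primrec.const none)
  have hstep : Primrec₂ fun (t : α) (s : Option (List A) × (ℕ × List A)) =>
      checkStep ok t.1.1 s.1 s.2 :=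
    Primrec.option_bind (Primrec.fst.comp Primrec.snd) hif
  have hadd : Primrec₂ fun (t : α) (s : ℕ × (ℕ × List A)) => s.1 + 2 ^ (t.1.1 + 1 - s.2.1) := by
    have h1 : Primrec fun t : α × ℕ × (ℕ × List A) => t.1.1.1 + 1 - t.2.2.1 :=
      Primrec.nat_sub.comp (Primrec.succ.comp (hL.comp Primrec.fst))
        (Primrec.fst.comp (Primrec.snd.comp Primrec.snd))
    exact Primrec.nat_add.comp (Primrec.fst.comp Primrec.snd) (primrec_two_pow.comp h1)
  have hfold : Primrec fun t : α => t.2.foldl (checkStep ok t.1.1) (some t.1.2.1) :=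
    Primrec.list_foldl Primrec.snd (Primrec.option_some.comp hu) hstep
  have hcost : Primrec fun t : α => t.2.foldl (fun a p => a + 2 ^ (t.1.1 + 1 - p.1)) 0 :=
    Primrec.list_foldl Primrec.snd (Primrec.const 0) hadd
  have hnil : PrimrecPred fun t : α => t.2 ≠ [] :=
    PrimrecPred.not (Primrec.eq.comp Primrec.snd (Primrec.const []))
  have hden : Primrec fun t : α => 2 ^ t.1.1 - 1 :=
    Primrec.nat_sub.comp (primrec_two_pow.comp hL) (Primrec.const 1)
  exact Primrec.ite (hnil.and (Primrec.eq.comp hfold (Primrec.option_some.comp hv)))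
    (Primrec.option_some.comp (hcost.pair hden)) (Primrec.const none)

/-- Costs are counted in units of `1 / 2^L`. The bound on the levels makes the truncated subtraction
exact. -/
theorem foldl_add_two_pow (L : ℕ) (steps : List (ℕ × List A)) (hL : ∀ p ∈ steps, p.1 ≤ L) :
    ((steps.foldl (fun a p => a + 2 ^ (L + 1 - p.1)) 0 : ℕ) : ℝ) =
      cost (steps.map Prod.fst) * 2 ^ L := by
  have key : ∀ a : ℕ, ((steps.foldl (fun a p => a + 2 ^ (L + 1 - p.1)) a : ℕ) : ℝ) =
      a + cost (steps.map Prod.fst) * 2 ^ L := by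
    induction steps with
    | nil => simp
    | cons p steps ih =>
      intro a
      rw [List.foldl_cons, ih (fun q hq => hL q (by simp [hq])), List.map_cons, cost_cons]
      have hp : p.1 ≤ L := hL p (by simp)
      have e : (2 : ℝ) ^ (L + 1 - p.1) = 2 * (1 / 2) ^ p.1 * 2 ^ L := by
        rw [pow_sub₀ _ two_ne_zero (by omega), pow_succ]
        simp only [one_div, inv_pow]
        ring
      push_cast
      rw [e]
      ring
  simpa using key 0

theorem extRat_dyadic {x : ℕ} {r : ℝ} {L : ℕ} (h : (x : ℝ) = r * 2 ^ L) :
    extRat (some (x, 2 ^ L - 1)) = ENNReal.ofReal r := by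
  have h1 : ((2 ^ L - 1 : ℕ) : ℝ≥0∞) + 1 = 2 ^ L := by
    have : 2 ^ L - 1 + 1 = 2 ^ L := Nat.sub_add_cancel Nat.one_le_two_pow
    exact_mod_cast this
  simp only [extRat, h1]
  have h2 : (x : ℝ≥0∞) = ENNReal.ofReal r * 2 ^ L := by
    rw [← ENNReal.ofReal_natCast, h, ENNReal.ofReal_mul' (by positivity),
      ENNReal.ofReal_pow (by norm_num)]
    simp
  rw [h2, ENNReal.mul_div_cancel_right (by simp) (by finiteness)]

end Enumeration

/-! ### Upper semicomputability by enumeration of chains -/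

section UpperSemicomputable

variable {M A : Type*} [AddCommMonoidWithOne M] {win : ℕ → List M} {Y : Set (M → A)}
  {Z : Set (M → A × A)}

/-- `ok` decides whether a step between words of the window number `L` is a step between near
points. -/
def DecidesSteps (win : ℕ → List M) (Y : Set (M → A)) (Z : Set (M → A × A)) (c : ℕ)
    (ok : (ℕ × List A) × (ℕ × List A) → Bool) : Prop :=
  ∀ (L n : ℕ) (x : Y) (w : List A), ok ((L, word win (c * L) (x : M → A)), (n, w)) = true ↔
    n ≤ L ∧ ∃ y : Y, word win (c * L) (y : M → A) = w ∧ Near win Y Z (c * n) x y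

theorem exists_decidesSteps [Finite A] [Primcodable A] [TopologicalSpace A]
    [DiscreteTopology A] (hw : IsWindows win) (h : IsSoficPerSofic Y Z) (c : ℕ) :
    ∃ ok : (ℕ × List A) × (ℕ × List A) → Bool, Primrec ok ∧ DecidesSteps win Y Z c ok := by
  obtain ⟨tr, htr, htr'⟩ := exists_primrec_restrict (A := A) hw
  obtain ⟨nd, hnd, hnd'⟩ := exists_primrec_related hw h
  -- The test `nd (w, w)` checks that `w` is a word of `Y`, since the relation is reflexive.
  refine ⟨fun t => (decide (t.2.1 ≤ t.1.1) && decide (t.2.2.length = (win (c * t.1.1)).length)) &&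
    (nd (t.2.2, t.2.2) && nd (tr ((c * t.2.1, c * t.1.1), t.1.2), tr ((c * t.2.1, c * t.1.1), t.2.2))),
    ?_, fun L n x w => ?_⟩
  · have hL : Primrec fun t : (ℕ × List A) × (ℕ × List A) => t.1.1 := Primrec.fst.comp Primrec.fst
    have hn : Primrec fun t : (ℕ × List A) × (ℕ × List A) => t.2.1 := Primrec.fst.comp Primrec.snd
    have hu : Primrec fun t : (ℕ × List A) × (ℕ × List A) => t.1.2 := Primrec.snd.comp Primrec.fst
    have hv : Primrec fun t : (ℕ × List A) × (ℕ × List A) => t.2.2 := Primrec.snd.comp Primrec.snd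
    have hc : ∀ {f : (ℕ × List A) × (ℕ × List A) → ℕ}, Primrec f → Primrec fun t => c * f t :=
      fun hf => Primrec.nat_mul.comp (Primrec.const c) hf
    exact Primrec.and.comp
      (Primrec.and.comp (Primrec.nat_le.comp hn hL).decide
        (Primrec.eq.comp (Primrec.list_length.comp hv) (hw.length_primrec.comp (hc hL))).decide)
      (Primrec.and.comp (hnd.comp (Primrec.pair hv hv)) (hnd.comp (Primrec.pair
        (htr.comp (Primrec.pair (Primrec.pair (hc hn) (hc hL)) hu))
        (htr.comp (Primrec.pair (Primrec.pair (hc hn) (hc hL)) hv)))))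
  · simp only [Bool.and_eq_true, decide_eq_true_eq]
    have key : ∀ y : Y, n ≤ L → (nd (tr ((c * n, c * L), word win (c * L) (x : M → A)),
        tr ((c * n, c * L), word win (c * L) (y : M → A))) = true ↔ Near win Y Z (c * n) x y) := by
      intro y hn
      have hle := Nat.mul_le_mul_left c hn
      rw [htr' _ _ hle, htr' _ _ hle, hnd' (c * n) _ _ (by simp [word]) (by simp [word]),
        near_iff_exists_word]
    constructor
    · rintro ⟨⟨hn, hlen⟩, hww, hnear⟩
      obtain ⟨y, -, rfl, -, -⟩ := (hnd' (c * L) w w hlen hlen).1 hww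
      exact ⟨hn, y, rfl, (key y hn).1 hnear⟩
    · rintro ⟨hn, y, rfl, hnear⟩
      exact ⟨⟨hn, by simp [word]⟩, (hnd' (c * L) _ _ (by simp [word]) (by simp [word])).2
        ⟨y, y, rfl, rfl, h.equivalence.refl y⟩, (key y hn).2 hnear⟩

theorem foldl_checkStep_none (ok : (ℕ × List A) × (ℕ × List A) → Bool) (L : ℕ)
    (steps : List (ℕ × List A)) : steps.foldl (checkStep ok L) none = none := by
  induction steps with
  | nil => rfl
  | cons p steps ih => exact ih

-- Chains of words lift to chains of points one step at a time: from any point with the current word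
-- there is a near point with the next word.
omit [AddCommMonoidWithOne M] in
theorem DecidesSteps.chain_of_foldl {c : ℕ} {ok : (ℕ × List A) × (ℕ × List A) → Bool}
    (hok : DecidesSteps win Y Z c ok) {L : ℕ} {steps : List (ℕ × List A)} {x : Y} {v : List A}
    (h : steps.foldl (checkStep ok L) (some (word win (c * L) (x : M → A))) = some v) :
    (∀ p ∈ steps, p.1 ≤ L) ∧ ∃ y : Y, word win (c * L) (y : M → A) = v ∧
      Chain (fun n => Near win Y Z (c * n)) (steps.map Prod.fst) x y := by
  induction steps generalizing x with
  | nil => exact ⟨by simp, x, by simpa using h, rfl⟩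
  | cons p steps ih =>
    rw [List.foldl_cons] at h
    simp only [checkStep, Option.bind_some] at h
    split_ifs at h with hp
    · obtain ⟨hn, z, hz, hxz⟩ := (hok L p.1 x p.2).1 hp
      rw [← hz] at h
      obtain ⟨hle, y, hy, hzy⟩ := ih h
      exact ⟨by simpa [hn] using hle, y, hy, z, hxz, hzy⟩
    · exact absurd ((foldl_checkStep_none ok L steps).symm.trans h) (by simp)

omit [AddCommMonoidWithOne M] in
theorem DecidesSteps.exists_foldl {c : ℕ} {ok : (ℕ × List A) × (ℕ × List A) → Bool}
    (hok : DecidesSteps win Y Z c ok) {L : ℕ} {l : List ℕ} {x y : Y} (hl : ∀ n ∈ l, n ≤ L)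
    (h : Chain (fun n => Near win Y Z (c * n)) l x y) :
    ∃ steps : List (ℕ × List A), steps.map Prod.fst = l ∧
      steps.foldl (checkStep ok L) (some (word win (c * L) (x : M → A))) =
        some (word win (c * L) (y : M → A)) := by
  induction l generalizing x with
  | nil => obtain rfl : x = y := h; exact ⟨[], rfl, rfl⟩
  | cons n l ih =>
    obtain ⟨z, hz, hzy⟩ := h
    obtain ⟨steps, hs, hf⟩ := ih (fun k hk => hl k (by simp [hk])) hzy
    refine ⟨(n, word win (c * L) (z : M → A)) :: steps, by simp [hs], ?_⟩
    rw [List.foldl_cons]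
    simp only [checkStep, Option.bind_some]
    rw [if_pos ((hok L n x _).2 ⟨hl n (by simp), z, rfl, hz⟩)]
    exact hf

theorem upperSemicomputable_quotientDist [Finite A] [Primcodable A] [TopologicalSpace A]
    [DiscreteTopology A] (hw : IsWindows win) (h : IsSoficPerSofic Y Z) {c : ℕ} :
    UpperSemicomputable win (quotientDist win Y Z c) := by
  classical
  obtain ⟨tr, htr, htr'⟩ := exists_primrec_restrict (A := A) hw
  obtain ⟨ok, hokp, hok⟩ := exists_decidesSteps hw h c
  -- The number `t.2` codes a level `L` and a list of steps. It counts only from stage `L` on, when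
  -- the window `c * L` can be read off; from then on its value is constant, which makes the minima
  -- decrease.
  let val : ((List A × List A) × ℕ) × ℕ → Option (ℕ × ℕ) := fun t =>
    (Encodable.decode (α := ℕ × List (ℕ × List A)) t.2).bind fun q =>
      if q.1 ≤ t.1.2 then chainValue ok q.1 (tr ((c * q.1, c * t.1.2), t.1.1.1))
        (tr ((c * q.1, c * t.1.2), t.1.1.2)) q.2 else none
  have hval : Primrec val := by
    let α := (((List A × List A) × ℕ) × ℕ) × (ℕ × List (ℕ × List A))
    have hq : Primrec fun s : α => s.2 := Primrec.snd
    have hm : Primrec fun s : α => s.1.1.2 := Primrec.snd.comp (Primrec.fst.comp Primrec.fst)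
    have hc : Primrec fun s : α => (c * s.2.1, c * s.1.1.2) :=
      (Primrec.nat_mul.comp (Primrec.const c) (Primrec.fst.comp hq)).pair
        (Primrec.nat_mul.comp (Primrec.const c) hm)
    have hw : Primrec fun s : α => s.1.1.1 := Primrec.fst.comp (Primrec.fst.comp Primrec.fst)
    have h1 : Primrec fun s : α => tr ((c * s.2.1, c * s.1.1.2), s.1.1.1.1) :=
      htr.comp (hc.pair (Primrec.fst.comp hw))
    have h2 : Primrec fun s : α => tr ((c * s.2.1, c * s.1.1.2), s.1.1.1.2) :=
      htr.comp (hc.pair (Primrec.snd.comp hw))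
    have h3 : Primrec fun s : α => chainValue ok s.2.1 (tr ((c * s.2.1, c * s.1.1.2), s.1.1.1.1))
        (tr ((c * s.2.1, c * s.1.1.2), s.1.1.1.2)) s.2.2 :=
      (primrec_chainValue hokp).comp
        (((Primrec.fst.comp hq).pair (h1.pair h2)).pair (Primrec.snd.comp hq))
    have h4 : Primrec₂ fun (t : ((List A × List A) × ℕ) × ℕ) (q : ℕ × List (ℕ × List A)) =>
        if q.1 ≤ t.1.2 then chainValue ok q.1 (tr ((c * q.1, c * t.1.2), t.1.1.1))
          (tr ((c * q.1, c * t.1.2), t.1.1.2)) q.2 else none :=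
      Primrec.ite (Primrec.nat_le.comp (Primrec.fst.comp hq) hm) h3 (Primrec.const none)
    exact Primrec.option_bind (Primrec.decode.comp Primrec.snd) h4
  let g : (List A × List A) × ℕ → Option (ℕ × ℕ) := fun t => minUpTo (fun k => val (t, k)) t.2
  have hmin : Primrec₂ fun (t : (List A × List A) × ℕ) (s : Option (ℕ × ℕ) × ℕ) =>
      minCode s.1 (val (t, s.2)) :=
    primrec_minCode.comp (Primrec.fst.comp Primrec.snd)
      (hval.comp (Primrec.fst.pair (Primrec.snd.comp Primrec.snd)))
  have hg : Primrec g :=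
    Primrec.list_foldl (Primrec.list_range.comp (Primrec.succ.comp Primrec.snd))
      (Primrec.const none) hmin
  have hlev : Primrec fun m : ℕ => c * m := Primrec.nat_mul.comp (Primrec.const c) Primrec.id
  refine ⟨_, computableOnPoints_of_primrec hw.length_strictMono hw.length_primrec hlev hg,
    fun x y => ?_⟩
  let V : ℕ → ℕ → Option (ℕ × ℕ) := fun m k =>
    val (((word win (c * m) (x : M → A), word win (c * m) (y : M → A)), m), k)
  have hV : ∀ m k, V m k = (Encodable.decode (α := ℕ × List (ℕ × List A)) k).bind fun q =>
      if q.1 ≤ m then chainValue ok q.1 (word win (c * q.1) (x : M → A))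
        (word win (c * q.1) (y : M → A)) q.2 else none := by
    intro m k
    simp only [V, val]
    congr 1
    ext1 q
    split_ifs with hq
    · rw [htr' _ _ (Nat.mul_le_mul_left c hq), htr' _ _ (Nat.mul_le_mul_left c hq)]
    · rfl
  change Antitone (fun m => extRat (minUpTo (V m) m)) ∧
    Tendsto (fun m => extRat (minUpTo (V m) m)) atTop (𝓝 (quotientDist win Y Z c x y))
  have hanti : Antitone fun m => extRat (minUpTo (V m) m) := by
    intro m m' hm
    rw [le_extRat_minUpTo]
    intro k hk
    refine ((le_extRat_minUpTo _ _ _).1 le_rfl k (hk.trans hm)).trans ?_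
    rw [hV, hV]
    cases Encodable.decode (α := ℕ × List (ℕ × List A)) k with
    | none => rfl
    | some q =>
      simp only [Option.bind_some]
      by_cases hq : q.1 ≤ m
      · rw [if_pos hq, if_pos (hq.trans hm)]
      · rw [if_neg hq]
        exact le_top
  refine ⟨hanti, ?_⟩
  suffices hinf : ⨅ m, extRat (minUpTo (V m) m) = quotientDist win Y Z c x y by
    rw [← hinf]
    exact tendsto_atTop_iInf hanti
  refine le_antisymm ?_ (le_iInf fun m => (le_extRat_minUpTo _ _ _).2 fun k _ => ?_)
  · refine le_iInf₂ fun l hl => ?_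
    have hN : ∀ N : ℕ, ⨅ m, extRat (minUpTo (V m) m) ≤ ENNReal.ofReal (cost l) + weight N := by
      intro N
      -- A cheap loop at `y` is appended so that the chain is nonempty even for `l = []`; its cost
      -- vanishes as `N` grows.
      have hl' : Chain (fun n => Near win Y Z (c * n)) (l ++ [N]) x y :=
        chain_append.2 ⟨y, hl, chain_singleton.2 (Near.refl h.equivalence y)⟩
      have hL : ∀ n ∈ l ++ [N], n ≤ (l ++ [N]).sum := fun n hn => List.single_le_sum (by simp) n hn
      obtain ⟨steps, hs, hf⟩ := hok.exists_foldl hL hl'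
      set L := (l ++ [N]).sum
      let k := Encodable.encode (L, steps)
      refine (iInf_le _ (max L k)).trans (((le_extRat_minUpTo _ _ _).1 le_rfl k
        (le_max_right _ _)).trans ?_)
      rw [hV, Encodable.encodek, Option.bind_some, if_pos (le_max_left _ _), chainValue, if_pos,
        extRat_dyadic (foldl_add_two_pow L steps ?_), hs, cost_append,
        ENNReal.ofReal_add (cost_nonneg _) (cost_nonneg _), weight_eq_ofReal]
      · simp
      · intro p hp
        exact hL _ (hs ▸ List.mem_map_of_mem hp)
      · refine ⟨?_, hf⟩
        rintro rfl
        simp at hs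
    have htend : Tendsto (fun N => ENNReal.ofReal (cost l) + weight N) atTop
        (𝓝 (ENNReal.ofReal (cost l) + 0)) := tendsto_const_nhds.add tendsto_weight
    rw [add_zero] at htend
    exact ge_of_tendsto' htend hN
  · rw [hV]
    cases Encodable.decode (α := ℕ × List (ℕ × List A)) k with
    | none => exact le_top
    | some q =>
      rw [Option.bind_some]
      split_ifs with hq
      · rw [chainValue]
        split_ifs with hv
        · obtain ⟨hle, y', hy', hc⟩ := hok.chain_of_foldl hv.2
          rw [extRat_dyadic (foldl_add_two_pow q.1 q.2 hle)]
          -- The lifted chain ends at a point that merely shares the word of `y`, and is redirected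
          -- to `y` at the same cost.
          refine chainDist_le (chain_congr hw (by simpa using hv.1) (fun i hi => ?_) rfl
            (wordOf_eq_of_word_eq hy') hc)
          obtain ⟨p, hp, rfl⟩ := List.mem_map.1 hi
          exact hle p hp
        · exact le_top
      · exact le_top

theorem exists_quotientDist [Finite A] [Primcodable A] [TopologicalSpace A]
    [DiscreteTopology A] (hw : IsWindows win) (h : IsSoficPerSofic Y Z) :
    ∃ (c : ℕ) (d : Y → Y → ℝ≥0∞),
      IsGreatest (boundedPseudometrics win Y Z c) d ∧
      (∀ x y : Y, d x y = ⊤ ↔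
        ¬ (wordGraph win Y Z 0).Reachable (wordOf win 0 x) (wordOf win 0 y)) ∧
      Metrizes h.equivalence d ∧ UpperSemicomputable win d ∧ ComputablyApproximable win d := by
  obtain ⟨c, hc, hU⟩ := exists_isContracting hw h
  exact ⟨c, quotientDist win Y Z c, isGreatest_quotientDist h.equivalence c,
    fun x y => quotientDist_eq_top_iff hw h.equivalence, metrizes_quotientDist hw h hc hU,
    upperSemicomputable_quotientDist hw h, computablyApproximable_quotientDist hw h hU⟩

end UpperSemicomputable

end SoficQuotient

theorem theorem4 {A : Type*} [Finite A] [TopologicalSpace A] [DiscreteTopology A] [Primcodable A] :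
    (∀ (Y : Set (ℤ → A)) (Z : Set (ℤ → A × A)) (h : IsSoficPerSofic Y Z),
      ∃ (c : ℕ) (d : Y → Y → ℝ≥0∞),
        IsGreatest (boundedPseudometrics centered Y Z c) d ∧
        (∀ x y : Y, d x y = ⊤ ↔
          ¬ (wordGraph centered Y Z 0).Reachable (wordOf centered 0 x) (wordOf centered 0 y)) ∧
        Metrizes h.equivalence d ∧
        UpperSemicomputable centered d ∧
        ComputablyApproximable centered d) ∧
    (∀ (Y : Set (ℕ → A)) (Z : Set (ℕ → A × A)) (h : IsSoficPerSofic Y Z),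
      ∃ (c : ℕ) (d : Y → Y → ℝ≥0∞),
        IsGreatest (boundedPseudometrics initial Y Z c) d ∧
        (∀ x y : Y, d x y = ⊤ ↔
          ¬ (wordGraph initial Y Z 0).Reachable (wordOf initial 0 x) (wordOf initial 0 y)) ∧
        Metrizes h.equivalence d ∧
        UpperSemicomputable initial d ∧
        ComputablyApproximable initial d) := by
  exact ⟨fun Y Z h => exists_quotientDist centered_isWindows h,
    fun Y Z h => exists_quotientDist initial_isWindows h⟩
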